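/- Let $\mathcal V$ be a cartesian closed category with finite limits and small coproducts. Write $1$ for its terminal object and, for a set $I$, write $I\bullet 1=\coprod_{i\in I}1$; a map of sets $u:I\to J$ induces $u\bullet 1:I\bullet 1\to J\bullet 1$. Let - $\mathcal V\text{-}\mathrm{Mat}$ be the pseudo-double category whose $0$-cells are small sets, whose vertical $1$-cells are maps of sets, whose horizontal $1$-cells $I\to J$ are families $(M(i,j))_{i\in I,j\in J}$ of objects of $\mathcal V$, and whose $2$-cells $M\to N$ over $(u,v)$ are families of morphisms $M(i,j)\to N(u(i),v(j))$; horizontal composition is matrix multiplication, with entries $\coprod_j M(i,j)\times N(j,k)$; - $\mathrm{Span}_d(\mathcal V)$ be the pseudo-double category with the same $0$-cells and vertical $1$-cells, whose horizontal $1$-cells $I\to J$ are spans $I\bullet 1\leftarrow A\to J\bullet 1$, and whose $2$-cells $A\to B$ over $(u,v)$ are morphisms $A\to B$ compatible with $u\bullet 1$ and $v\bullet 1$; horizontal composition is by pullback; - $\mathrm{Int}:\mathcal V\text{-}\mathrm{Mat}\to\mathrm{Span}_d(\mathcal V)$ be the oplax double functor that is the identity on $0$-cells and vertical $1$-cells and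 sends $M$ to $I\bullet 1\leftarrow\coprod_{i,j}M(i,j)\to J\bullet 1$; - $\mathrm{En}:\mathrm{Span}_d(\mathcal V)\to\mathcal V\text{-}\mathrm{Mat}$ be the lax double functor that is the identity on $0$-cells and vertical $1$-cells and sends a span $A$ to the matrix whose $(i,j)$ entry is the pullback of $A\to (I\bullet 1)\times(J\bullet 1)$ along the point $(i,j)$. Suppose that one of the following conditions (which are known to be equivalent) holds: 1. for every small set $I$ the adjunction $\coprod\dashv\langle i^*\rangle_{i\in I}$ between $\mathcal V^I$ and $\mathcal V/(I\bullet 1)$, whose right adjoint pulls back along the coprojections $1\to I\bullet 1$, is an adjoint equivalence; 2. $\mathcal V$ is extensive, i.e. for every small family $(X_i)_{i\in I}$ of objects the functor $\coprod:\prod_{i}(\mathcal V/X_i)\to\mathcal V/(\coprod_i X_i)$ is an equivalence of categories; 3. $\mathrm{Int}$ is a double equivalence (its comparison $2$-cells are invertible, and it induces an equivalence between the categories of horizontal $1$-cells and $2$-cells); 4. $\mathrm{En}$ is a double equivalence (in the same sense). Then the following two categories are equivalent: - $\mathcal V\text{-}\mathrm{Cat}$, the category of small $\mathcal V$-enriched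 categories (for the cartesian monoidal structure) and $\mathcal V$-functors; - $\mathrm{Cat}_d(\mathcal V)$, the category of discretely internal categories in $\mathcal V$: an object is a small set $I$ together with a category internal in $\mathcal V$ whose object of objects is $I\bullet 1$, and a morphism from $(I,C)$ to $(J,D)$ is a map of sets $u:I\to J$ together with an internal functor $C\to D$ whose component on objects of objects is $u\bullet 1$. -/

import Mathlib

open CategoryTheory CategoryTheory.Limits MonoidalCategory CartesianMonoidalCategory

universe w v u

noncomputable section

namespace EnrichedInternal

/-! ### Extensivity -/

section Extensivity

variable {V : Type u} [Category.{v} V] [HasCoproducts.{w} V]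

/-- The functor `∏ᵢ (V / Xᵢ) ⥤ V / (∐ᵢ Xᵢ)` sending `(fᵢ)ᵢ` to `∐ᵢ fᵢ`. -/
def coprodOver {I : Type w} (X : I → V) : (∀ i, Over (X i)) ⥤ Over (∐ X) where
  obj f := Over.mk (Limits.Sigma.map fun i => (f i).hom)
  map {f g} φ := Over.homMk (Limits.Sigma.map fun i => (φ i).left) (by
    apply Limits.Sigma.hom_ext
    intro i
    simp)
  map_id f := by
    ext : 1
    apply Limits.Sigma.hom_ext
    intro i
    simp
  map_comp φ ψ := by
    ext : 1
    apply Limits.Sigma.hom_ext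
    intro i
    simp

variable (V) in
/-- A category with small coproducts is extensive if for every small family `X` the functor
`coprodOver X` is an equivalence of categories. -/
def IsExtensive : Prop :=
  ∀ (I : Type w) (X : I → V), (coprodOver X).IsEquivalence

end Extensivity

variable (V : Type u) [Category.{v} V] [CartesianMonoidalCategory V]

section Copowers

variable [HasCoproducts.{w} V]

/-- The discrete object `I • 1`, the coproduct of `I` copies of the terminal object `1 = 𝟙_ V`. -/
def disc (I : Type w) : V := ∐ fun _ : I => 𝟙_ V

variable {V} in
/-- The coprojection `1 ⟶ I • 1` at `i`. -/
def discι {I : Type w} (i : I) : 𝟙_ V ⟶ disc V I := Limits.Sigma.ι (fun _ : I => 𝟙_ V) i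

/-- The morphism `u • 1 : I • 1 ⟶ J • 1` induced by a map of sets `u : I → J`. -/
def discMap {I J : Type w} (u : I → J) : disc V I ⟶ disc V J :=
  Limits.Sigma.desc fun i => discι (u i)

variable {V} in
/-- Morphisms out of `I • 1` are determined by their composites with the coprojections. -/
theorem disc_hom_ext {I : Type w} {X : V} {f g : disc V I ⟶ X}
    (h : ∀ i, discι i ≫ f = discι i ≫ g) : f = g :=
  Limits.Sigma.hom_ext _ _ h

@[simp]
theorem discι_discMap {I J : Type w} (u : I → J) (i : I) :
    discι i ≫ discMap V u = discι (u i) :=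
  Limits.Sigma.ι_desc _ _

@[simp]
theorem discMap_id (I : Type w) : discMap V (fun i : I => i) = 𝟙 (disc V I) :=
  disc_hom_ext fun i => by simp

@[simp]
theorem discMap_id' (I : Type w) : discMap V (id : I → I) = 𝟙 (disc V I) :=
  discMap_id V I

theorem discMap_comp {I J K : Type w} (u : I → J) (u' : J → K) :
    discMap V (fun i => u' (u i)) = discMap V u ≫ discMap V u' :=
  disc_hom_ext fun i => by
    rw [discι_discMap, ← Category.assoc, discι_discMap, discι_discMap]

end Copowers

/-! ### The adjunction between `V^I` and `V / (I • 1)` -/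

section Adjunction

variable [HasCoproducts.{w} V]

/-- The functor `V^I ⥤ V / (I • 1)` sending `(Xᵢ)ᵢ` to the coproduct `∐ᵢ Xᵢ` with the morphism to
`I • 1` induced by the terminal morphisms `Xᵢ ⟶ 1`. -/
def coprodDisc (I : Type w) : (I → V) ⥤ Over (disc V I) where
  obj X := Over.mk (Y := ∐ X) (Limits.Sigma.desc fun i => toUnit (X i) ≫ discι i)
  map {X Y} φ := Over.homMk (Limits.Sigma.map φ) (by
    apply Limits.Sigma.hom_ext
    intro i
    simp)
  map_id X := by
    ext : 1
    apply Limits.Sigma.hom_ext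
    intro i
    simp
  map_comp φ ψ := by
    ext : 1
    apply Limits.Sigma.hom_ext
    intro i
    simp

variable [HasPullbacks V]

variable {V} in
/-- Morphisms into a fiber are determined by their composites with the first projection. -/
theorem fiber_hom_ext {I : Type w} {A : Over (disc V I)} {i : I} {T : V}
    {f g : T ⟶ pullback A.hom (discι i)}
    (h : f ≫ pullback.fst _ _ = g ≫ pullback.fst _ _) : f = g :=
  pullback.hom_ext h (toUnit_unique _ _)

/-- The functor `V / (I • 1) ⥤ V^I` sending `A ⟶ I • 1` to the family of its pullbacks along the
coprojections `1 ⟶ I • 1`. -/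
def fibers (I : Type w) : Over (disc V I) ⥤ (I → V) where
  obj A i := pullback A.hom (discι i)
  map {A B} f i := pullback.lift (pullback.fst _ _ ≫ f.left) (pullback.snd _ _)
    (by simp [pullback.condition])
  map_id A := by
    funext i
    apply fiber_hom_ext
    simp
  map_comp {A B C} f g := by
    funext i
    apply fiber_hom_ext
    refine (pullback.lift_fst _ _ _).trans ?_
    change _ = (pullback.lift _ _ _ ≫ pullback.lift _ _ _) ≫ pullback.fst _ _
    rw [Category.assoc, pullback.lift_fst, pullback.lift_fst_assoc, Category.assoc]
    rfl

variable {V} in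
/-- The transpose of a morphism `∐ X ⟶ A` over `I • 1`. -/
def toFibers {I : Type w} {X : I → V} {A : Over (disc V I)} (f : (coprodDisc V I).obj X ⟶ A)
    (i : I) : X i ⟶ pullback A.hom (discι i) :=
  pullback.lift (Limits.Sigma.ι X i ≫ (f.left : ∐ X ⟶ A.left)) (toUnit _)
    ((Category.assoc _ _ _).trans ((congrArg (Limits.Sigma.ι X i ≫ ·) (Over.w f)).trans
      (Limits.Sigma.ι_desc _ _)))

variable {V} in
/-- The transpose of a family of morphisms into the fibers of `A ⟶ I • 1`. -/
def ofFibers {I : Type w} {X : I → V} {A : Over (disc V I)}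
    (g : ∀ i, X i ⟶ pullback A.hom (discι i)) : (coprodDisc V I).obj X ⟶ A :=
  Over.homMk (Limits.Sigma.desc fun i => g i ≫ pullback.fst _ _ : ∐ X ⟶ A.left) (by
    apply Limits.Sigma.hom_ext
    intro i
    refine (Limits.Sigma.ι_desc_assoc _ _ _).trans (Eq.trans ?_ (Limits.Sigma.ι_desc _ _).symm)
    rw [Category.assoc, pullback.condition, ← Category.assoc]
    exact congrArg (· ≫ discι i) (toUnit_unique _ _))

/-- The adjunction `∐ ⊣ ⟨i*⟩` between `V^I` and `V / (I • 1)`. -/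
def coprodDiscAdj (I : Type w) : coprodDisc V I ⊣ fibers V I :=
  Adjunction.mkOfHomEquiv
    { homEquiv := fun X A =>
        { toFun := fun f => toFibers f
          invFun := fun g => ofFibers g
          left_inv := fun f => by
            ext : 1
            apply Limits.Sigma.hom_ext
            intro i
            exact (Limits.Sigma.ι_desc _ _).trans (pullback.lift_fst _ _ _)
          right_inv := fun g => by
            funext i
            apply fiber_hom_ext
            exact (pullback.lift_fst _ _ _).trans (Limits.Sigma.ι_desc _ _) }
      homEquiv_naturality_left_symm := fun {X X' A} f g => by
        ext : 1
        apply Limits.Sigma.hom_ext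
        intro i
        refine (Limits.Sigma.ι_desc _ _).trans ?_
        have h : Limits.Sigma.ι X i ≫ Limits.Sigma.map f ≫ (ofFibers g).left =
            f i ≫ g i ≫ pullback.fst _ _ :=
          (Limits.Sigma.ι_map_assoc _ _ _).trans
            (congrArg (f i ≫ ·) (Limits.Sigma.ι_desc _ _))
        exact (Category.assoc _ _ _).trans h.symm
      homEquiv_naturality_right := fun {X A B} f g => by
        funext i
        apply fiber_hom_ext
        refine (pullback.lift_fst _ _ _).trans ?_
        change _ = (toFibers f i ≫ pullback.lift _ _ _) ≫ pullback.fst _ _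
        rw [Category.assoc, pullback.lift_fst, toFibers, pullback.lift_fst_assoc]
        exact (Category.assoc (Limits.Sigma.ι X i) f.left g.left).symm }

/-- For every small set `I`, the adjunction between `V^I` and `V / (I • 1)` is an adjoint
equivalence. -/
def DiscAdjunctionsAreEquivalences : Prop :=
  ∀ I : Type w, IsIso (coprodDiscAdj V I).unit ∧ IsIso (coprodDiscAdj V I).counit

end Adjunction

/-! ### Matrices -/

/-- A `V`-valued matrix between small sets. These are the horizontal 1-cells of the pseudo-double
category of matrices; the 0-cells are the small sets and the vertical 1-cells the maps of sets. -/
structure MatrixCell where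
  src : Type w
  tgt : Type w
  entry : src → tgt → V

namespace MatrixCell

variable {V}

/-- A 2-cell of the pseudo-double category of matrices. -/
@[ext]
structure Hom (M N : MatrixCell.{w} V) where
  srcMap : M.src → N.src
  tgtMap : M.tgt → N.tgt
  app : ∀ i j, M.entry i j ⟶ N.entry (srcMap i) (tgtMap j)

/-- The category of horizontal 1-cells and 2-cells (under vertical composition). -/
instance : Category (MatrixCell.{w} V) where
  Hom := Hom
  id _ := ⟨fun i => i, fun j => j, fun _ _ => 𝟙 _⟩
  comp f g := ⟨fun i => g.srcMap (f.srcMap i), fun j => g.tgtMap (f.tgtMap j),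
    fun i j => f.app i j ≫ g.app _ _⟩
  id_comp _ := congrArg (Hom.mk _ _) (funext fun _ => funext fun _ => Category.id_comp _)
  comp_id _ := congrArg (Hom.mk _ _) (funext fun _ => funext fun _ => Category.comp_id _)
  assoc _ _ _ := congrArg (Hom.mk _ _) (funext fun _ => funext fun _ => Category.assoc _ _ _)

end MatrixCell

section

variable [HasCoproducts.{w} V]

variable {V} in
/-- Horizontal composition of matrices: `(M ; N)(i,k) = ∐ⱼ M(i,j) × N(j,k)`. -/
abbrev matComp {I J K : Type w} (M : I → J → V) (N : J → K → V) : I → K → V :=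
  fun i k => ∐ fun j => M i j ⊗ N j k

/-- The unit matrix: the `(i,j)` entry is the coproduct of copies of `1` indexed by the proofs of
`i = j`, hence is `1` if `i = j` and the initial object otherwise. -/
abbrev matId (I : Type w) : I → I → V :=
  fun i j => ∐ fun _ : ULift.{w} (PLift (i = j)) => 𝟙_ V

end

/-! ### Discrete spans -/

section

variable [HasCoproducts.{w} V]

/-- A span `I • 1 ⟵ A ⟶ J • 1` between discrete objects. -/
structure DiscSpan (I J : Type w) where
  apex : V
  left : apex ⟶ disc V I
  right : apex ⟶ disc V J

/-- The identity span on `I • 1`. -/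
abbrev DiscSpan.id (I : Type w) : DiscSpan V I I := ⟨disc V I, 𝟙 _, 𝟙 _⟩

variable {V} in
/-- Composition of spans by pullback. -/
abbrev DiscSpan.comp [HasPullbacks V] {I J K : Type w} (A : DiscSpan V I J) (B : DiscSpan V J K) :
    DiscSpan V I K :=
  ⟨pullback A.right B.left, pullback.fst _ _ ≫ A.left, pullback.snd _ _ ≫ B.right⟩

/-- A discrete span together with its end sets: the horizontal 1-cells of the pseudo-double category
of discrete spans. The 0-cells are the small sets and the vertical 1-cells the maps of sets. -/
structure SpanCell where
  src : Type w
  tgt : Type w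
  span : DiscSpan V src tgt

namespace SpanCell

variable {V}

/-- A 2-cell of the pseudo-double category of discrete spans. -/
@[ext]
structure Hom (A B : SpanCell.{w} V) where
  srcMap : A.src → B.src
  tgtMap : A.tgt → B.tgt
  app : A.span.apex ⟶ B.span.apex
  app_left : app ≫ B.span.left = A.span.left ≫ discMap V srcMap
  app_right : app ≫ B.span.right = A.span.right ≫ discMap V tgtMap

/-- The category of horizontal 1-cells and 2-cells (under vertical composition). -/
instance : Category (SpanCell.{w} V) where
  Hom := Hom
  id A := ⟨fun i => i, fun j => j, 𝟙 _, by simp, by simp⟩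
  comp f g := ⟨fun i => g.srcMap (f.srcMap i), fun j => g.tgtMap (f.tgtMap j), f.app ≫ g.app,
    by rw [Category.assoc, g.app_left, ← Category.assoc, f.app_left, Category.assoc, ← discMap_comp],
    by rw [Category.assoc, g.app_right, ← Category.assoc, f.app_right, Category.assoc,
      ← discMap_comp]⟩
  id_comp _ := Hom.ext rfl rfl (Category.id_comp _)
  comp_id _ := Hom.ext rfl rfl (Category.comp_id _)
  assoc _ _ _ := Hom.ext rfl rfl (Category.assoc _ _ _)

end SpanCell

end

/-! ### The oplax double functor `Int` from matrices to discrete spans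

It is the identity on 0-cells and on vertical 1-cells. -/

section Int

variable [HasCoproducts.{w} V]

variable {V} in
/-- `Int` on horizontal 1-cells: the span `I • 1 ⟵ ∐ᵢⱼ M(i,j) ⟶ J • 1`. -/
abbrev intSpan {I J : Type w} (M : I → J → V) : DiscSpan V I J where
  apex := ∐ fun p : I × J => M p.1 p.2
  left := Limits.Sigma.desc fun p => toUnit _ ≫ discι p.1
  right := Limits.Sigma.desc fun p => toUnit _ ≫ discι p.2

/-- `Int` on horizontal 1-cells and 2-cells. -/
def intFunctor : MatrixCell.{w} V ⥤ SpanCell.{w} V where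
  obj M := ⟨M.src, M.tgt, intSpan M.entry⟩
  map {M N} f :=
    { srcMap := f.srcMap
      tgtMap := f.tgtMap
      app := Limits.Sigma.desc fun p =>
        f.app p.1 p.2 ≫ Limits.Sigma.ι (fun q : N.src × N.tgt => N.entry q.1 q.2) (f.srcMap p.1, f.tgtMap p.2)
      app_left := by
        apply Limits.Sigma.hom_ext
        intro p
        simp [intSpan]
      app_right := by
        apply Limits.Sigma.hom_ext
        intro p
        simp [intSpan] }
  map_id M := by
    apply SpanCell.Hom.ext
    · rfl
    · rfl
    · apply Limits.Sigma.hom_ext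
      intro p
      exact (Limits.Sigma.ι_desc _ _).trans ((Category.id_comp _).trans (Category.comp_id _).symm)
  map_comp {M N P} f g := by
    apply SpanCell.Hom.ext
    · rfl
    · rfl
    · apply Limits.Sigma.hom_ext
      intro p
      refine (Limits.Sigma.ι_desc _ _).trans ?_
      change (f.app p.1 p.2 ≫ g.app _ _) ≫ _ =
        Limits.Sigma.ι (fun q : M.src × M.tgt => M.entry q.1 q.2) p ≫ Limits.Sigma.desc _ ≫
          Limits.Sigma.desc fun q : N.src × N.tgt =>
            g.app q.1 q.2 ≫ Limits.Sigma.ι (fun r : P.src × P.tgt => P.entry r.1 r.2)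
              (g.srcMap q.1, g.tgtMap q.2)
      rw [Limits.Sigma.ι_desc_assoc, Category.assoc, Category.assoc, Limits.Sigma.ι_desc]
      rfl

variable [HasPullbacks V]

variable {V} in
/-- The comparison 2-cell `Int (M ; N) ⟶ Int M ; Int N` of the oplax double functor `Int`. -/
def intComp {I J K : Type w} (M : I → J → V) (N : J → K → V) :
    SpanCell.mk I K (intSpan (matComp M N)) ⟶
      SpanCell.mk I K ((intSpan M).comp (intSpan N)) where
  srcMap i := i
  tgtMap k := k
  app := Limits.Sigma.desc fun p => Limits.Sigma.desc fun j =>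
    pullback.lift
      (fst _ _ ≫ Limits.Sigma.ι (fun q : I × J => M q.1 q.2) (p.1, j))
      (snd _ _ ≫ Limits.Sigma.ι (fun q : J × K => N q.1 q.2) (j, p.2))
      (by simp [intSpan])
  app_left := by
    apply Limits.Sigma.hom_ext
    intro p
    apply Limits.Sigma.hom_ext
    intro j
    simp [intSpan, DiscSpan.comp, matComp, pullback.lift_fst_assoc]
  app_right := by
    apply Limits.Sigma.hom_ext
    intro p
    apply Limits.Sigma.hom_ext
    intro j
    simp [intSpan, DiscSpan.comp, matComp, pullback.lift_snd_assoc]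

/-- The comparison 2-cell from `Int` of the unit matrix to the identity span. -/
def intUnit (I : Type w) :
    SpanCell.mk I I (intSpan (matId V I)) ⟶ SpanCell.mk I I (DiscSpan.id V I) where
  srcMap i := i
  tgtMap i := i
  app := Limits.Sigma.desc fun p => Limits.Sigma.desc fun _ => discι p.1
  app_left := by
    apply Limits.Sigma.hom_ext
    intro p
    apply Limits.Sigma.hom_ext
    intro h
    simp [intSpan, DiscSpan.id, matId]
  app_right := by
    apply Limits.Sigma.hom_ext
    rintro ⟨i, j⟩
    apply Limits.Sigma.hom_ext
    rintro ⟨⟨h⟩⟩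
    obtain rfl : i = j := h
    simp [intSpan, DiscSpan.id, matId]

/-- The oplax double functor `Int` is a double equivalence: its comparison 2-cells are invertible
and it is an equivalence on the categories of horizontal 1-cells and 2-cells (on the categories of
0-cells and vertical 1-cells it is the identity). -/
def IntIsDoubleEquivalence : Prop :=
  (∀ (I J K : Type w) (M : I → J → V) (N : J → K → V), IsIso (intComp M N)) ∧
  (∀ I : Type w, IsIso (intUnit V I)) ∧
  (intFunctor.{w} V).IsEquivalence

end Int

/-! ### The lax double functor `En` from discrete spans to matrices

It is the identity on 0-cells and on vertical 1-cells. -/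

section En

variable [HasCoproducts.{w} V] [HasPullbacks V]

variable {V} in
/-- `En` on horizontal 1-cells: the `(i,j)` entry is the pullback of `A ⟶ I • 1 × J • 1` along the
point `(i,j)`. -/
def enMatrix {I J : Type w} (A : DiscSpan V I J) : I → J → V :=
  fun i j => pullback (lift A.left A.right) (lift (discι i) (discι j))

variable {V} in
/-- The universal property of the entries of `enMatrix`. -/
def enLift {I J : Type w} (A : DiscSpan V I J) {T : V} (i : I) (j : J) (f : T ⟶ A.apex)
    (hl : f ≫ A.left = toUnit T ≫ discι i) (hr : f ≫ A.right = toUnit T ≫ discι j) :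
    T ⟶ enMatrix A i j :=
  pullback.lift f (toUnit T) (by simp [hl, hr])

variable {V} in
/-- The morphism `En A (i,j) ⟶ A`. -/
def enι {I J : Type w} (A : DiscSpan V I J) (i : I) (j : J) : enMatrix A i j ⟶ A.apex :=
  pullback.fst _ _

@[simp]
theorem enLift_enι {I J : Type w} (A : DiscSpan V I J) {T : V} (i : I) (j : J) (f : T ⟶ A.apex)
    (hl : f ≫ A.left = toUnit T ≫ discι i) (hr : f ≫ A.right = toUnit T ≫ discι j) :
    enLift A i j f hl hr ≫ enι A i j = f :=
  pullback.lift_fst _ _ _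

theorem enι_left {I J : Type w} (A : DiscSpan V I J) (i : I) (j : J) :
    enι A i j ≫ A.left = toUnit _ ≫ discι i := by
  have h := pullback.condition (f := lift A.left A.right) (g := lift (discι i) (discι j))
  have h' := congrArg (· ≫ fst _ _) h
  simp only [Category.assoc, lift_fst] at h'
  exact h'.trans (congrArg (· ≫ discι i) (toUnit_unique _ _))

theorem enι_right {I J : Type w} (A : DiscSpan V I J) (i : I) (j : J) :
    enι A i j ≫ A.right = toUnit _ ≫ discι j := by
  have h := pullback.condition (f := lift A.left A.right) (g := lift (discι i) (discι j))
  have h' := congrArg (· ≫ snd _ _) h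
  simp only [Category.assoc, lift_snd] at h'
  exact h'.trans (congrArg (· ≫ discι j) (toUnit_unique _ _))

variable {V} in
theorem enMatrix_hom_ext {I J : Type w} (A : DiscSpan V I J) {i : I} {j : J} {T : V}
    {f g : T ⟶ enMatrix A i j} (h : f ≫ enι A i j = g ≫ enι A i j) : f = g :=
  pullback.hom_ext h (toUnit_unique _ _)

variable {V} in
/-- `En` on 2-cells, entrywise. -/
def enApp {A B : SpanCell.{w} V} (f : A ⟶ B) (i : A.src) (j : A.tgt) :
    enMatrix A.span i j ⟶ enMatrix B.span (f.srcMap i) (f.tgtMap j) :=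
  enLift B.span _ _ (enι A.span i j ≫ f.app)
    (by rw [Category.assoc, f.app_left, ← Category.assoc, enι_left, Category.assoc, discι_discMap])
    (by rw [Category.assoc, f.app_right, ← Category.assoc, enι_right, Category.assoc,
      discι_discMap])

variable {V} in
theorem enApp_enι {A B : SpanCell.{w} V} (f : A ⟶ B) (i : A.src) (j : A.tgt) :
    enApp f i j ≫ enι B.span _ _ = enι A.span i j ≫ f.app :=
  enLift_enι _ _ _ _ _ _ _

/-- `En` on horizontal 1-cells and 2-cells. -/
def enFunctor : SpanCell.{w} V ⥤ MatrixCell.{w} V where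
  obj A := ⟨A.src, A.tgt, enMatrix A.span⟩
  map {A B} f := ⟨f.srcMap, f.tgtMap, enApp f⟩
  map_id A := by
    refine congrArg (MatrixCell.Hom.mk _ _) ?_
    funext i j
    apply enMatrix_hom_ext
    exact (enApp_enι _ _ _).trans ((Category.comp_id _).trans (Category.id_comp _).symm)
  map_comp {A B C} f g := by
    refine congrArg (MatrixCell.Hom.mk _ _) ?_
    funext i j
    apply enMatrix_hom_ext
    refine (enApp_enι _ _ _).trans ?_
    change enι A.span i j ≫ f.app ≫ g.app = (enApp f i j ≫ enApp g _ _) ≫ enι _ _ _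
    rw [Category.assoc, enApp_enι, ← Category.assoc, ← Category.assoc, enApp_enι]

variable {V} in
/-- The comparison 2-cell `En A ; En B ⟶ En (A ; B)` of the lax double functor `En`. -/
def enComp {I J K : Type w} (A : DiscSpan V I J) (B : DiscSpan V J K) :
    MatrixCell.mk I K (matComp (enMatrix A) (enMatrix B)) ⟶
      MatrixCell.mk I K (enMatrix (A.comp B)) where
  srcMap i := i
  tgtMap k := k
  app i k := Limits.Sigma.desc fun j => enLift (A.comp B) i k
    (pullback.lift (fst _ _ ≫ enι A i j) (snd _ _ ≫ enι B j k)
      (by simp [enι_left, enι_right]))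
    (by simp [DiscSpan.comp, pullback.lift_fst_assoc, enι_left])
    (by simp [DiscSpan.comp, pullback.lift_snd_assoc, enι_right])

/-- The comparison 2-cell from the unit matrix to `En` of the identity span. -/
def enUnit (I : Type w) :
    MatrixCell.mk I I (matId V I) ⟶ MatrixCell.mk I I (enMatrix (DiscSpan.id V I)) where
  srcMap i := i
  tgtMap i := i
  app i j := Limits.Sigma.desc fun h => enLift (DiscSpan.id V I) i j (discι i)
    (by simp [DiscSpan.id])
    (by simp [DiscSpan.id, h.down.down])

/-- The lax double functor `En` is a double equivalence: its comparison 2-cells are invertible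
and it is an equivalence on the categories of horizontal 1-cells and 2-cells (on the categories of
0-cells and vertical 1-cells it is the identity). -/
def EnIsDoubleEquivalence : Prop :=
  (∀ (I J K : Type w) (A : DiscSpan V I J) (B : DiscSpan V J K), IsIso (enComp A B)) ∧
  (∀ I : Type w, IsIso (enUnit V I)) ∧
  (enFunctor.{w} V).IsEquivalence

end En

/-! ### The category of small `V`-categories -/

/-- A small category enriched in the cartesian monoidal category `V`. -/
structure VCat where
  carrier : Type w
  [str : EnrichedCategory V carrier]

attribute [instance] VCat.str

/-- The category of small `V`-categories and `V`-functors. -/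
instance : Category (VCat.{w} V) where
  Hom C D := EnrichedFunctor V C.carrier D.carrier
  id C := EnrichedFunctor.id V C.carrier
  comp F G := EnrichedFunctor.comp V F G
  id_comp _ := EnrichedFunctor.ext V (fun _ => rfl)
    (fun _ _ => (Category.comp_id _).trans (Category.id_comp _))
  comp_id _ := EnrichedFunctor.ext V (fun _ => rfl)
    (fun _ _ => (Category.comp_id _).trans (Category.comp_id _))
  assoc _ _ _ := EnrichedFunctor.ext V (fun _ => rfl)
    (fun _ _ => (Category.comp_id _).trans (Category.assoc _ _ _))

/-! ### Internal categories -/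

section Internal

variable {V} [HasPullbacks V]

/-- A category internal in `V` with object of objects `O`. Composition is in diagrammatic order, so
the object of composable pairs is the pullback of `tgt` and `src`. Associativity is expressed on
generalized elements of the object of composable triples. -/
structure InternalCategoryOn (O : V) where
  Mor : V
  src : Mor ⟶ O
  tgt : Mor ⟶ O
  ident : O ⟶ Mor
  comp : pullback tgt src ⟶ Mor
  ident_src : ident ≫ src = 𝟙 O
  ident_tgt : ident ≫ tgt = 𝟙 O
  comp_src : comp ≫ src = pullback.fst tgt src ≫ src
  comp_tgt : comp ≫ tgt = pullback.snd tgt src ≫ tgt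
  ident_comp : pullback.lift (src ≫ ident) (𝟙 Mor) (by simp [ident_tgt]) ≫ comp = 𝟙 Mor
  comp_ident : pullback.lift (𝟙 Mor) (tgt ≫ ident) (by simp [ident_src]) ≫ comp = 𝟙 Mor
  assoc : ∀ {T : V} (f g h : T ⟶ Mor) (hfg : f ≫ tgt = g ≫ src) (hgh : g ≫ tgt = h ≫ src),
    pullback.lift (pullback.lift f g hfg ≫ comp) h (by rw [Category.assoc, comp_tgt, pullback.lift_snd_assoc, hgh]) ≫ comp =
      pullback.lift f (pullback.lift g h hgh ≫ comp) (by rw [Category.assoc, comp_src, pullback.lift_fst_assoc, hfg]) ≫ comp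

/-- An internal functor whose component on objects of objects is `f₀`. -/
structure InternalFunctorOver {O O' : V} (f₀ : O ⟶ O') (C : InternalCategoryOn O)
    (D : InternalCategoryOn O') where
  map : C.Mor ⟶ D.Mor
  map_src : map ≫ D.src = C.src ≫ f₀
  map_tgt : map ≫ D.tgt = C.tgt ≫ f₀
  map_ident : C.ident ≫ map = f₀ ≫ D.ident
  map_comp : C.comp ≫ map =
    pullback.lift (pullback.fst C.tgt C.src ≫ map) (pullback.snd C.tgt C.src ≫ map)
      (by simp only [Category.assoc, map_src, map_tgt, pullback.condition_assoc]) ≫ D.comp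

variable [HasCoproducts.{w} V]

variable (V) in
/-- A discretely internal category in `V`: a small set `I` and a category internal in `V` whose
object of objects is the discrete object `I • 1`. -/
structure DiscIntCat where
  objs : Type w
  cat : InternalCategoryOn (disc V objs)

namespace DiscIntCat

/-- A morphism of discretely internal categories: a map of sets `u` and an internal functor which
is `u • 1` on objects of objects. -/
structure Hom (C D : DiscIntCat.{w} V) where
  onObjs : C.objs → D.objs
  functor : InternalFunctorOver (discMap V onObjs) C.cat D.cat

theorem Hom.ext' {C D : DiscIntCat.{w} V} {F G : Hom C D} (h : F.onObjs = G.onObjs)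
    (h' : F.functor.map = G.functor.map) : F = G := by
  obtain ⟨u, ⟨f, _, _, _, _⟩⟩ := F
  obtain ⟨u', ⟨f', _, _, _, _⟩⟩ := G
  obtain rfl : u = u' := h
  obtain rfl : f = f' := h'
  rfl

/-- The identity morphism. -/
def Hom.id (C : DiscIntCat.{w} V) : Hom C C where
  onObjs i := i
  functor :=
    { map := 𝟙 _
      map_src := by simp
      map_tgt := by simp
      map_ident := by simp
      map_comp := by
        have : pullback.lift (pullback.fst C.cat.tgt C.cat.src ≫ 𝟙 _)
            (pullback.snd C.cat.tgt C.cat.src ≫ 𝟙 _)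
            (by simp [pullback.condition]) = 𝟙 (pullback C.cat.tgt C.cat.src) := by
          apply pullback.hom_ext <;> simp
        rw [this, Category.comp_id, Category.id_comp] }

/-- The composite of two morphisms. -/
def Hom.comp {C D E : DiscIntCat.{w} V} (F : Hom C D) (G : Hom D E) : Hom C E where
  onObjs i := G.onObjs (F.onObjs i)
  functor :=
    { map := F.functor.map ≫ G.functor.map
      map_src := by
        rw [Category.assoc, G.functor.map_src, ← Category.assoc, F.functor.map_src, Category.assoc,
          ← discMap_comp]
      map_tgt := by
        rw [Category.assoc, G.functor.map_tgt, ← Category.assoc, F.functor.map_tgt, Category.assoc,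
          ← discMap_comp]
      map_ident := by
        rw [← Category.assoc, F.functor.map_ident, Category.assoc, G.functor.map_ident,
          ← Category.assoc, ← discMap_comp]
      map_comp := by
        rw [← Category.assoc, F.functor.map_comp, Category.assoc, G.functor.map_comp,
          ← Category.assoc]
        congr 1
        apply pullback.hom_ext
        · rw [Category.assoc, pullback.lift_fst, pullback.lift_fst, pullback.lift_fst_assoc,
            Category.assoc]
        · rw [Category.assoc, pullback.lift_snd, pullback.lift_snd, pullback.lift_snd_assoc,
            Category.assoc] }

/-- The category `Cat_d(V)` of discretely internal categories in `V`. -/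
instance : Category (DiscIntCat.{w} V) where
  Hom := Hom
  id := Hom.id
  comp := Hom.comp
  id_comp _ := Hom.ext' rfl (Category.id_comp _)
  comp_id _ := Hom.ext' rfl (Category.comp_id _)
  assoc _ _ _ := Hom.ext' rfl (Category.assoc _ _ _)

end DiscIntCat

end Internal

end EnrichedInternal

end

/-!
Why the theorem holds. The matrix `En C` of a discretely internal category `C` has as entry `(i, j)`
the object of morphisms of `C` from `i` to `j`, and the structure of `C` restricts to these
hom-objects. This gives a functor `enCat` from discretely internal categories to `V`-categories
without any assumption on `V`: it is the action of the lax double functor `En` on horizontal monads.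
The four hypotheses are used to show that `enCat` is an equivalence.

All that is needed of them is `DecomposesOverDiscrete`: an object over `I • 1` is the coproduct of
its fibers, and `M i j` is the fiber of `∐ᵢⱼ M i j` over `(i, j)`. For the first hypothesis these two
statements are the invertibility of the counit and of the unit, the second one after splitting
`∐ᵢⱼ` into `∐ᵢ ∐ⱼ`. Extensivity implies the first hypothesis, since `V / 1` is `V`. For the last two
hypotheses, `Int` is left adjoint to `En` on horizontal 1-cells and 2-cells (`intEnAdj`), so that
the unit and counit of this adjunction are invertible as soon as one of the two functors is an
equivalence.

Given the decomposition, morphisms out of an object equipped with morphisms to discrete objects can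
be compared and constructed on generalized elements lying over fixed points
(`DecomposesOverDiscrete.hom_ext`, `DecomposesOverDiscrete.existsUnique_glue`). Applied to the object
of morphisms and to the object of composable pairs of `C`, this shows that `enCat` is full and
faithful. Applied to the pullback of `∐ᵢⱼ H i j` with itself over `I • 1`, for the hom-objects `H` of
a `V`-category, it extends the composition to the total object `∐ᵢⱼ H i j`, and reduces the laws of an
internal category to those of the `V`-category; the second half of `DecomposesOverDiscrete` says that
the hom-objects of this internal category are the given ones, so `enCat` is essentially surjective.
-/

noncomputable section

namespace EnrichedInternal

/-! ### Universal properties along an isomorphism -/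

section UniversalProperties

variable {C : Type u} [Category.{v} C]

theorem existsUnique_desc_of_isIso {I : Type w} [HasCoproducts.{w} C] {B : I → C} {A Z : C}
    (e : ∐ B ⟶ A) [IsIso e] {b : ∀ i, B i ⟶ A} (he : ∀ i, Limits.Sigma.ι B i ≫ e = b i)
    (φ : ∀ i, B i ⟶ Z) : ∃! f : A ⟶ Z, ∀ i, b i ≫ f = φ i := by
  refine ⟨inv e ≫ Limits.Sigma.desc φ, fun i => ?_, fun g hg => ?_⟩
  · simp [← he]
  · refine (IsIso.eq_inv_comp e).mpr (Limits.Sigma.hom_ext _ _ fun i => ?_)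
    rw [← Category.assoc, he, hg, Limits.Sigma.ι_desc]

theorem existsUnique_factor_of_isIso {X P A T : C} (e : X ⟶ P) [IsIso e] {p : P ⟶ A} {m : X ⟶ A}
    (he : e ≫ p = m) {f : T ⟶ A} (f' : T ⟶ P) (hf' : f' ≫ p = f)
    (hp : ∀ g h : T ⟶ P, g ≫ p = h ≫ p → g = h) : ∃! g : T ⟶ X, g ≫ m = f := by
  refine ⟨f' ≫ inv e, by simp [← he, hf'], fun g hg => (IsIso.eq_comp_inv e).mpr (hp _ _ ?_)⟩
  rw [Category.assoc, he, hg, hf']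

end UniversalProperties

/-! ### The total object of a matrix -/

section Decomposition

variable {V : Type u} [Category.{v} V] [HasCoproducts.{w} V]

/-- The apex `∐ᵢⱼ M i j` of the span `intSpan M`. -/
abbrev total {I J : Type w} (M : I → J → V) : V := ∐ fun p : I × J => M p.1 p.2

/-- The coprojection `M i j ⟶ ∐ᵢⱼ M i j`. -/
def totalι {I J : Type w} (M : I → J → V) (i : I) (j : J) : M i j ⟶ total M :=
  Limits.Sigma.ι (fun p : I × J => M p.1 p.2) (i, j)

theorem total_hom_ext {I J : Type w} {M : I → J → V} {Z : V} {f g : total M ⟶ Z}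
    (h : ∀ i j, totalι M i j ≫ f = totalι M i j ≫ g) : f = g :=
  Limits.Sigma.hom_ext _ _ fun p => h p.1 p.2

/-- Morphisms out of `total M` are families of morphisms out of the entries. -/
def totalDesc {I J : Type w} {M : I → J → V} {Z : V} (φ : ∀ i j, M i j ⟶ Z) : total M ⟶ Z :=
  Limits.Sigma.desc fun p => φ p.1 p.2

@[simp]
theorem totalι_totalDesc {I J : Type w} {M : I → J → V} {Z : V} (φ : ∀ i j, M i j ⟶ Z)
    (i : I) (j : J) : totalι M i j ≫ totalDesc φ = φ i j :=
  Limits.Sigma.ι_desc _ _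

variable [CartesianMonoidalCategory V]

/-- The left leg of the span `intSpan M`. -/
def totalSrc {I J : Type w} (M : I → J → V) : total M ⟶ disc V I :=
  (intSpan M).left

/-- The right leg of the span `intSpan M`. -/
def totalTgt {I J : Type w} (M : I → J → V) : total M ⟶ disc V J :=
  (intSpan M).right

@[simp]
theorem totalι_totalSrc {I J : Type w} (M : I → J → V) (i : I) (j : J) :
    totalι M i j ≫ totalSrc M = toUnit _ ≫ discι i :=
  Limits.Sigma.ι_desc _ _

@[simp]
theorem totalι_totalTgt {I J : Type w} (M : I → J → V) (i : I) (j : J) :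
    totalι M i j ≫ totalTgt M = toUnit _ ≫ discι j :=
  Limits.Sigma.ι_desc _ _

/-! ### Decomposition over discrete objects -/

variable [HasPullbacks V]

variable (V) in
/-- The common content of the four hypotheses: an object over `I • 1` is the coproduct of its
fibers, and the entry `M i j` of a matrix is the fiber of `∐ᵢⱼ M i j` over `(i, j)`. -/
structure DecomposesOverDiscrete : Prop where
  desc : ∀ {I : Type w} {A Z : V} (a : A ⟶ disc V I) (φ : ∀ i, pullback a (discι i) ⟶ Z),
    ∃! f : A ⟶ Z, ∀ i, pullback.fst a (discι i) ≫ f = φ i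
  factor : ∀ {I J : Type w} (M : I → J → V) {i : I} {j : J} {T : V} (f : T ⟶ total M),
    f ≫ totalSrc M = toUnit T ≫ discι i → f ≫ totalTgt M = toUnit T ≫ discι j →
      ∃! g : T ⟶ M i j, g ≫ totalι M i j = f

/-! ### The adjunctions between `V^I` and `V / (I • 1)` -/

/-- The counit of `∐ ⊣ ⟨i*⟩` is the cotupling of the inclusions of the fibers. -/
theorem ι_coprodDiscAdj_counit {I : Type w} (A : Over (disc V I)) (i : I) :
    Limits.Sigma.ι ((fibers V I).obj A) i ≫
      (show ∐ (fibers V I).obj A ⟶ A.left from ((coprodDiscAdj V I).counit.app A).left) =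
        pullback.fst A.hom (discι i) :=
  (Limits.Sigma.ι_desc _ _).trans (Category.id_comp _)

/-- The unit of `∐ ⊣ ⟨i*⟩` consists of the comparisons with the fibers of the coproduct. -/
theorem coprodDiscAdj_unit_fst {I : Type w} (X : I → V) (i : I) :
    (show X i ⟶ pullback ((coprodDisc V I).obj X).hom (discι i) from
      (coprodDiscAdj V I).unit.app X i) ≫ pullback.fst _ _ = Limits.Sigma.ι X i :=
  (pullback.lift_fst _ _ _).trans (Category.comp_id _)

/-- If the unit of `∐ ⊣ ⟨i*⟩` is invertible, each summand `X i` is the fiber of `∐ X` at `i`. -/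
theorem existsUnique_factor_sigma {I : Type w} [IsIso (coprodDiscAdj V I).unit] (X : I → V) {i : I}
    {T : V} (f : T ⟶ ∐ X)
    (hf : f ≫ (Limits.Sigma.desc fun i => toUnit (X i) ≫ discι i) = toUnit T ≫ discι i) :
    ∃! g : T ⟶ X i, g ≫ Limits.Sigma.ι X i = f := by
  have : IsIso (show X i ⟶ pullback ((coprodDisc V I).obj X).hom (discι i) from
      (coprodDiscAdj V I).unit.app X i) :=
    inferInstanceAs (IsIso ((Pi.eval (fun _ : I => V) i).map ((coprodDiscAdj V I).unit.app X)))
  exact existsUnique_factor_of_isIso _ (coprodDiscAdj_unit_fst X i)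
    (pullback.lift f (toUnit T) hf) (pullback.lift_fst _ _ _) fun _ _ => fiber_hom_ext

theorem DiscAdjunctionsAreEquivalences.decomposesOverDiscrete
    (h : DiscAdjunctionsAreEquivalences.{w} V) : DecomposesOverDiscrete.{w} V where
  desc {I A Z} a φ := by
    have := (h I).2
    have : IsIso (show ∐ (fibers V I).obj (Over.mk a) ⟶ (Over.mk a).left from
        ((coprodDiscAdj V I).counit.app (Over.mk a)).left) :=
      inferInstanceAs (IsIso ((Over.forget _).map ((coprodDiscAdj V I).counit.app (Over.mk a))))
    exact existsUnique_desc_of_isIso _ (ι_coprodDiscAdj_counit (Over.mk a)) φ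
  factor {I J} M {i j T} f hl hr := by
    have := (h I).1
    have := (h J).1
    -- `∐ᵢⱼ M i j` is the iterated coproduct `∐ᵢ ∐ⱼ M i j`, so one index is split off at a time.
    let N : I → V := fun i => ∐ M i
    let e : total M ⟶ ∐ N := totalDesc fun i j => Limits.Sigma.ι (M i) j ≫ Limits.Sigma.ι N i
    let e' : ∐ N ⟶ total M := Limits.Sigma.desc fun i => Limits.Sigma.desc fun j => totalι M i j
    have hιe (i : I) (j : J) : totalι M i j ≫ e = Limits.Sigma.ι (M i) j ≫ Limits.Sigma.ι N i := by
      simp [e]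
    have hιe' (i : I) (j : J) :
        Limits.Sigma.ι (M i) j ≫ Limits.Sigma.ι N i ≫ e' = totalι M i j := by
      simp [e', N]
    have hee' : e ≫ e' = 𝟙 _ := total_hom_ext fun i j => by
      rw [← Category.assoc, hιe, Category.assoc, hιe', Category.comp_id]
    have he : e ≫ (Limits.Sigma.desc fun i => toUnit (N i) ≫ discι i) = totalSrc M :=
      total_hom_ext fun i j => by
        rw [← Category.assoc, hιe, Category.assoc, Limits.Sigma.ι_desc, totalι_totalSrc,
          ← Category.assoc, toUnit_unique (_ ≫ toUnit _) (toUnit _)]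
    have hN (i : I) : Limits.Sigma.ι N i ≫ e' ≫ totalTgt M =
        Limits.Sigma.desc fun j => toUnit (M i j) ≫ discι j :=
      Limits.Sigma.hom_ext _ _ fun j => by
        rw [← Category.assoc, ← Category.assoc, Category.assoc (Limits.Sigma.ι (M i) j), hιe',
          totalι_totalTgt, Limits.Sigma.ι_desc]
    obtain ⟨g, hg : g ≫ Limits.Sigma.ι N i = f ≫ e, hgu⟩ :=
      existsUnique_factor_sigma N (f ≫ e) (by rw [Category.assoc, he, hl])
    obtain ⟨k, hk : k ≫ Limits.Sigma.ι (M i) j = g, hku⟩ := existsUnique_factor_sigma (M i) g (by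
      rw [← hN, ← Category.assoc, hg, Category.assoc, reassoc_of% hee', hr])
    refine ⟨k, ?_, fun k' hk' => hku k' (hgu _ ?_)⟩
    · change k ≫ totalι M i j = f
      rw [← hιe', ← Category.assoc, hk, ← Category.assoc, hg, Category.assoc, hee',
        Category.comp_id]
    · change (k' ≫ _) ≫ _ = _
      rw [← hk', Category.assoc, Category.assoc, hιe]

/-! ### Extensivity -/

/-- The slice over the terminal object is trivial, so `∐ : V^I ⥤ V / (I • 1)` is the case `Xᵢ = 1`
of the functors in the definition of extensivity. -/
def coprodDiscIso (I : Type w) :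
    Functor.pi (fun _ : I => (Over.equivalenceOfIsTerminal
      (isTerminalTensorUnit (C := V))).inverse) ⋙ coprodOver (fun _ : I => 𝟙_ V) ≅
      coprodDisc V I :=
  NatIso.ofComponents (fun X => Over.isoMk (Iso.refl (∐ X)) (by
    apply Limits.Sigma.hom_ext
    intro i
    refine (congrArg (_ ≫ ·) (Category.id_comp _)).trans ?_
    refine (Limits.Sigma.ι_desc _ _).trans (Eq.trans ?_ (Limits.Sigma.ι_map
      (fun i => isTerminalTensorUnit.from (X i)) i).symm)
    exact congrArg (· ≫ discι i) (toUnit_unique _ _))) fun f => by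
      ext : 1
      exact (Category.comp_id _).trans (Category.id_comp _).symm

theorem IsExtensive.discAdjunctionsAreEquivalences (h : IsExtensive.{w} V) :
    DiscAdjunctionsAreEquivalences.{w} V := fun I => by
  have : (coprodOver fun _ : I => 𝟙_ V).IsEquivalence := h I fun _ => 𝟙_ V
  have : (Functor.pi fun _ : I => (Over.equivalenceOfIsTerminal
      (isTerminalTensorUnit (C := V))).inverse).IsEquivalence := inferInstance
  have := Functor.isEquivalence_trans (Functor.pi fun _ : I => (Over.equivalenceOfIsTerminal
      (isTerminalTensorUnit (C := V))).inverse) (coprodOver fun _ : I => 𝟙_ V)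
  have : (coprodDisc V I).IsEquivalence :=
    @Functor.isEquivalence_of_iso _ _ _ _ _ _ (coprodDiscIso I) this
  have : (coprodDisc V I).IsLeftAdjoint := (coprodDiscAdj V I).isLeftAdjoint
  have : (fibers V I).IsEquivalence := (coprodDiscAdj V I).isEquivalence_right_of_isEquivalence_left
  exact ⟨inferInstance, inferInstance⟩
end Decomposition

/-! ### The adjunction between `Int` and `En` -/

section IntEn

variable {V : Type u} [Category.{v} V] [CartesianMonoidalCategory V] [HasCoproducts.{w} V]

/-- The 2-cell `Int f` on apexes. -/
def totalMap {M N : MatrixCell.{w} V} (f : M ⟶ N) : total M.entry ⟶ total N.entry :=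
  ((intFunctor V).map f).app

theorem totalι_totalMap {M N : MatrixCell.{w} V} (f : M ⟶ N) (i : M.src) (j : M.tgt) :
    totalι M.entry i j ≫ totalMap f =
      f.app i j ≫ totalι N.entry (f.srcMap i) (f.tgtMap j) :=
  Limits.Sigma.ι_desc _ _

variable [HasPullbacks V]

/-- The comparison of an entry of `M` with the corresponding entry of `En (Int M)`. -/
def toEnTotal {I J : Type w} (M : I → J → V) (i : I) (j : J) :
    M i j ⟶ enMatrix (intSpan M) i j :=
  enLift (intSpan M) i j (totalι M i j) (totalι_totalSrc M i j) (totalι_totalTgt M i j)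

theorem toEnTotal_enι {I J : Type w} (M : I → J → V) (i : I) (j : J) :
    toEnTotal M i j ≫ enι (intSpan M) i j = totalι M i j :=
  enLift_enι _ _ _ _ _ _ _

/-- The comparison of the apex of `Int (En A)` with the apex of `A`. -/
def ofTotalEn {I J : Type w} (A : DiscSpan V I J) : total (enMatrix A) ⟶ A.apex :=
  totalDesc (enι A)

theorem totalι_ofTotalEn {I J : Type w} (A : DiscSpan V I J) (i : I) (j : J) :
    totalι (enMatrix A) i j ≫ ofTotalEn A = enι A i j :=
  totalι_totalDesc _ _ _

theorem ofTotalEn_left {I J : Type w} (A : DiscSpan V I J) :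
    ofTotalEn A ≫ A.left = totalSrc (enMatrix A) :=
  total_hom_ext fun i j => by
    rw [← Category.assoc, totalι_ofTotalEn, enι_left, totalι_totalSrc]

theorem ofTotalEn_right {I J : Type w} (A : DiscSpan V I J) :
    ofTotalEn A ≫ A.right = totalTgt (enMatrix A) :=
  total_hom_ext fun i j => by
    rw [← Category.assoc, totalι_ofTotalEn, enι_right, totalι_totalTgt]

/-- The counit `Int (En A) ⟶ A`. -/
def intEnCounit (A : SpanCell.{w} V) : (intFunctor V).obj ((enFunctor V).obj A) ⟶ A where
  srcMap i := i
  tgtMap j := j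
  app := ofTotalEn A.span
  app_left := (ofTotalEn_left A.span).trans
    ((congrArg (totalSrc (enMatrix A.span) ≫ ·) (discMap_id V _)).trans (Category.comp_id _)).symm
  app_right := (ofTotalEn_right A.span).trans
    ((congrArg (totalTgt (enMatrix A.span) ≫ ·) (discMap_id V _)).trans (Category.comp_id _)).symm

variable (V) in
/-- On horizontal 1-cells and 2-cells, `Int` is left adjoint to `En`. -/
def intEnAdj : intFunctor.{w} V ⊣ enFunctor.{w} V :=
  Adjunction.mkOfUnitCounit
    { unit :=
        { app := fun M => MatrixCell.Hom.mk (fun i => i) (fun j => j) (toEnTotal M.entry)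
          naturality := fun M N f => congrArg (MatrixCell.Hom.mk _ _)
            (funext fun i => funext fun j => enMatrix_hom_ext _
              ((Category.assoc _ _ _).trans
                ((congrArg (f.app i j ≫ ·) (toEnTotal_enι N.entry _ _)).trans
                ((totalι_totalMap f i j).symm.trans
                ((congrArg (· ≫ totalMap f) (toEnTotal_enι M.entry i j).symm).trans
                ((Category.assoc _ _ _).trans
                ((congrArg (toEnTotal M.entry i j ≫ ·)
                  (enApp_enι ((intFunctor V).map f) i j).symm).trans
                (Category.assoc _ _ _).symm))))))) }
      counit :=
        { app := intEnCounit
          naturality := fun A B f => SpanCell.Hom.ext rfl rfl (total_hom_ext fun i j =>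
            (Category.assoc _ _ _).symm.trans
              ((congrArg (· ≫ ofTotalEn B.span) (totalι_totalMap ((enFunctor V).map f) i j)).trans
              ((Category.assoc _ _ _).trans
              ((congrArg (enApp f i j ≫ ·) (totalι_ofTotalEn B.span _ _)).trans
              ((enApp_enι f i j).trans
              ((congrArg (· ≫ f.app) (totalι_ofTotalEn A.span i j).symm).trans
              (Category.assoc _ _ _))))))) }
      left_triangle := by
        ext M
        let η : M ⟶ (enFunctor V).obj ((intFunctor V).obj M) :=
          MatrixCell.Hom.mk (fun i => i) (fun j => j) (toEnTotal M.entry)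
        refine SpanCell.Hom.ext rfl rfl (total_hom_ext fun i j => Eq.trans
          (congrArg (totalι M.entry i j ≫ ·) (congrArg (totalMap η ≫ ·) (Category.id_comp _))) ?_)
        exact (Category.assoc _ _ _).symm.trans
          ((congrArg (· ≫ ofTotalEn (intSpan M.entry)) (totalι_totalMap η i j)).trans
          ((Category.assoc _ _ _).trans
          ((congrArg (toEnTotal M.entry i j ≫ ·) (totalι_ofTotalEn (intSpan M.entry) i j)).trans
          ((toEnTotal_enι M.entry i j).trans (Category.comp_id _).symm))))
      right_triangle := by
        ext A
        refine congrArg (MatrixCell.Hom.mk _ _) (funext fun i => funext fun j =>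
          enMatrix_hom_ext A.span (Eq.trans (congrArg (· ≫ enι A.span i j)
            (congrArg (toEnTotal (enMatrix A.span) i j ≫ ·)
              (Category.id_comp (enApp (intEnCounit A) i j)))) ?_))
        exact (Category.assoc _ _ _).trans
          ((congrArg (toEnTotal (enMatrix A.span) i j ≫ ·) (enApp_enι (intEnCounit A) i j)).trans
          ((Category.assoc _ _ _).symm.trans
          ((congrArg (· ≫ ofTotalEn A.span) (toEnTotal_enι (enMatrix A.span) i j)).trans
          ((totalι_ofTotalEn A.span i j).trans (Category.id_comp _).symm)))) }

omit [HasCoproducts.{w} V] [HasPullbacks V] [CartesianMonoidalCategory V] in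
/-- An invertible 2-cell of matrices over identities has invertible entries. -/
theorem isIso_app_of_isIso {I J : Type w} {M N : I → J → V} (φ : ∀ i j, M i j ⟶ N i j)
    (h : IsIso (X := MatrixCell.mk I J M) (Y := MatrixCell.mk I J N)
      (MatrixCell.Hom.mk (fun i => i) (fun j => j) φ)) (i : I) (j : J) : IsIso (φ i j) := by
  obtain ⟨⟨s, t, ψ⟩, h₁, h₂⟩ := h
  obtain rfl : s = fun i => i := congrArg MatrixCell.Hom.srcMap h₁
  obtain rfl : t = fun j => j := congrArg MatrixCell.Hom.tgtMap h₁
  have h₁' := eq_of_heq (MatrixCell.Hom.mk.inj h₁).2.2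
  have h₂' := eq_of_heq (MatrixCell.Hom.mk.inj h₂).2.2
  exact ⟨ψ i j, congrFun (congrFun h₁' i) j, congrFun (congrFun h₂' i) j⟩

/-- The apex of a span, as a functor on horizontal 1-cells and 2-cells. -/
def apexFunctor : SpanCell.{w} V ⥤ V where
  obj A := A.span.apex
  map f := f.app

theorem decomposesOverDiscrete_of_isIso_intEnAdj (h₁ : IsIso (intEnAdj.{w} V).unit)
    (h₂ : IsIso (intEnAdj.{w} V).counit) : DecomposesOverDiscrete.{w} V where
  desc {I A Z} a φ := by
    -- `a` is regarded as a span from `I` to a one-element set.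
    let S : DiscSpan V I PUnit.{w + 1} := ⟨A, a, toUnit A ≫ discι PUnit.unit⟩
    have : IsIso (ofTotalEn S) :=
      inferInstanceAs
        (IsIso (apexFunctor.map ((intEnAdj V).counit.app (SpanCell.mk I PUnit S))))
    let p (i : I) : enMatrix S i PUnit.unit ⟶ pullback a (discι i) :=
      pullback.lift (enι S _ _) (toUnit _) (enι_left V S i PUnit.unit)
    let q (i : I) : pullback a (discι i) ⟶ enMatrix S i PUnit.unit :=
      enLift S i PUnit.unit (pullback.fst _ _)
        (pullback.condition.trans (congrArg (· ≫ _) (toUnit_unique _ _)))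
        ((Category.assoc _ _ _).symm.trans (congrArg (· ≫ _) (toUnit_unique _ _)))
    have hp (i : I) : p i ≫ pullback.fst _ _ = enι S i PUnit.unit := pullback.lift_fst _ _ _
    have hq (i : I) : q i ≫ enι S i PUnit.unit = pullback.fst _ _ := enLift_enι _ _ _ _ _ _ _
    have hqp (i : I) : q i ≫ p i = 𝟙 _ :=
      pullback.hom_ext (by rw [Category.assoc, hp, hq, Category.id_comp]) (toUnit_unique _ _)
    obtain ⟨f, hf, hfu⟩ := existsUnique_desc_of_isIso
      (B := fun r : I × PUnit.{w + 1} => enMatrix S r.1 r.2) (ofTotalEn S)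
      (b := fun r => enι S r.1 r.2) (fun r => totalι_ofTotalEn S r.1 r.2) fun r => p r.1 ≫ φ r.1
    refine ⟨f, fun i => ?_, fun g hg => hfu g fun r => ?_⟩
    · rw [← hq, Category.assoc]
      exact (congrArg (q i ≫ ·) (hf (i, PUnit.unit))).trans
        ((Category.assoc _ _ _).symm.trans ((congrArg (· ≫ φ i) (hqp i)).trans (Category.id_comp _)))
    · exact (congrArg (· ≫ g) (hp r.1).symm).trans
        ((Category.assoc _ _ _).trans (congrArg (p r.1 ≫ ·) (hg r.1)))
  factor {I J} M {i j T} f hl hr := by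
    have := isIso_app_of_isIso (toEnTotal M)
      (inferInstanceAs (IsIso ((intEnAdj V).unit.app (MatrixCell.mk I J M)))) i j
    exact existsUnique_factor_of_isIso _ (toEnTotal_enι M i j)
      (enLift (intSpan M) i j f hl hr) (enLift_enι _ _ _ _ _ _ _) fun _ _ => enMatrix_hom_ext _

theorem IntIsDoubleEquivalence.decomposesOverDiscrete (h : IntIsDoubleEquivalence.{w} V) :
    DecomposesOverDiscrete.{w} V := by
  have : (intFunctor.{w} V).IsEquivalence := h.2.2
  have := (intEnAdj.{w} V).isEquivalence_right_of_isEquivalence_left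
  exact decomposesOverDiscrete_of_isIso_intEnAdj inferInstance inferInstance

theorem EnIsDoubleEquivalence.decomposesOverDiscrete (h : EnIsDoubleEquivalence.{w} V) :
    DecomposesOverDiscrete.{w} V := by
  have : (enFunctor.{w} V).IsEquivalence := h.2.2
  have := (intEnAdj.{w} V).isEquivalence_left_of_isEquivalence_right
  exact decomposesOverDiscrete_of_isIso_intEnAdj inferInstance inferInstance

end IntEn

/-! ### Gluing over discrete objects -/

namespace DecomposesOverDiscrete

variable {V : Type u} [Category.{v} V] [CartesianMonoidalCategory V] [HasCoproducts.{w} V]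
  [HasPullbacks V] (hV : DecomposesOverDiscrete.{w} V)
include hV

/-- Morphisms out of an object over `I • 1` may be compared on generalized elements lying over a
single point of `I`. -/
theorem hom_ext {I : Type w} {A Z : V} (a : A ⟶ disc V I) {f g : A ⟶ Z}
    (h : ∀ i {S : V} (t : S ⟶ A), t ≫ a = toUnit S ≫ discι i → t ≫ f = t ≫ g) : f = g :=
  (hV.desc a fun i => pullback.fst a (discι i) ≫ g).unique
    (fun i => h i _ (pullback.condition.trans (congrArg (· ≫ _) (toUnit_unique _ _))))
    fun _ => rfl

/-- A property `Q` of pairs (element of `A`, element of `Z`), stable under restriction, which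
defines a function on the elements lying over each single point of `I`, defines a unique
morphism. -/
theorem existsUnique_glue {I : Type w} {A Z : V} (a : A ⟶ disc V I)
    (Q : ∀ (_ : I) {S : V} (_ : S ⟶ A) (_ : S ⟶ Z), Prop)
    (hQ : ∀ i {S S' : V} (r : S' ⟶ S) (t : S ⟶ A) (z : S ⟶ Z), Q i t z → Q i (r ≫ t) (r ≫ z))
    (h : ∀ i {S : V} (t : S ⟶ A), t ≫ a = toUnit S ≫ discι i → ∃! z : S ⟶ Z, Q i t z) :
    ∃! f : A ⟶ Z, ∀ i {S : V} (t : S ⟶ A), t ≫ a = toUnit S ≫ discι i → Q i t (t ≫ f) := by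
  have hp (i : I) : pullback.fst a (discι i) ≫ a = toUnit _ ≫ discι i :=
    pullback.condition.trans (congrArg (· ≫ _) (toUnit_unique _ _))
  choose φ hφ _ using fun i => h i _ (hp i)
  obtain ⟨f, hf, -⟩ := hV.desc a φ
  refine ⟨f, fun i S t ht => ?_, fun g hg => hV.hom_ext a fun i S t ht => ?_⟩
  · have := hQ i (pullback.lift t (toUnit S) ht) _ _ (hφ i)
    rwa [← hf i, ← Category.assoc, pullback.lift_fst] at this
  · have := hQ i (pullback.lift t (toUnit S) ht) _ _ (hφ i)
    rw [← hf i, ← Category.assoc, pullback.lift_fst] at this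
    exact (h i t ht).unique (hg i t ht) this

/-- Gluing along two morphisms to discrete objects, one after the other: the property glued along
`a` asserts that the restrictions along `b` are given by `Q`. -/
theorem existsUnique_glue₂ {I J : Type w} {A Z : V} (a : A ⟶ disc V I) (b : A ⟶ disc V J)
    (Q : ∀ (_ : I) (_ : J) {S : V} (_ : S ⟶ A) (_ : S ⟶ Z), Prop)
    (hQ : ∀ i j {S S' : V} (r : S' ⟶ S) (t : S ⟶ A) (z : S ⟶ Z),
      Q i j t z → Q i j (r ≫ t) (r ≫ z))
    (h : ∀ i j {S : V} (t : S ⟶ A), t ≫ a = toUnit S ≫ discι i → t ≫ b = toUnit S ≫ discι j →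
      ∃! z : S ⟶ Z, Q i j t z) :
    ∃! f : A ⟶ Z, ∀ i j {S : V} (t : S ⟶ A), t ≫ a = toUnit S ≫ discι i →
      t ≫ b = toUnit S ≫ discι j → Q i j t (t ≫ f) := by
  have key := hV.existsUnique_glue (Z := Z) a
    (fun i S t z => ∀ j {S' : V} (r : S' ⟶ S), r ≫ t ≫ b = toUnit S' ≫ discι j →
      Q i j (r ≫ t) (r ≫ z))
    (fun i S S' r t z H j S'' q hq => by
      have := H j (q ≫ r) (by rw [← hq, Category.assoc, Category.assoc])
      rwa [Category.assoc, Category.assoc] at this)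
    (fun i S t ht => hV.existsUnique_glue (t ≫ b) (fun j S' r z => Q i j (r ≫ t) z)
      (fun j S' S'' q r z H => by
        have := hQ i j q _ _ H
        rwa [← Category.assoc] at this)
      (fun j S' r hr => h i j (r ≫ t)
        (by rw [Category.assoc, ht, ← Category.assoc]; exact congrArg (· ≫ _) (toUnit_unique _ _))
        (by rw [Category.assoc, hr])))
  obtain ⟨f, hf, hfu⟩ := key
  refine ⟨f, fun i j S t ha hb => ?_, fun g hg => hfu g fun i S t ha j S' r hr => ?_⟩
  · have := hf i t ha j (𝟙 S) (by rw [Category.id_comp, hb])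
    rwa [Category.id_comp, Category.id_comp] at this
  · have := hg i j (r ≫ t)
      (by rw [Category.assoc, ha, ← Category.assoc]; exact congrArg (· ≫ _) (toUnit_unique _ _))
      (by rw [Category.assoc, hr])
    rwa [Category.assoc] at this

/-- Gluing along three morphisms to discrete objects, along `a` first. -/
theorem existsUnique_glue₃ {I J K : Type w} {A Z : V} (a : A ⟶ disc V I) (b : A ⟶ disc V J)
    (c : A ⟶ disc V K)
    (Q : ∀ (_ : I) (_ : J) (_ : K) {S : V} (_ : S ⟶ A) (_ : S ⟶ Z), Prop)
    (hQ : ∀ i j k {S S' : V} (r : S' ⟶ S) (t : S ⟶ A) (z : S ⟶ Z),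
      Q i j k t z → Q i j k (r ≫ t) (r ≫ z))
    (h : ∀ i j k {S : V} (t : S ⟶ A), t ≫ a = toUnit S ≫ discι i → t ≫ b = toUnit S ≫ discι j →
      t ≫ c = toUnit S ≫ discι k → ∃! z : S ⟶ Z, Q i j k t z) :
    ∃! f : A ⟶ Z, ∀ i j k {S : V} (t : S ⟶ A), t ≫ a = toUnit S ≫ discι i →
      t ≫ b = toUnit S ≫ discι j → t ≫ c = toUnit S ≫ discι k → Q i j k t (t ≫ f) := by
  have key := hV.existsUnique_glue (Z := Z) a
    (fun i S t z => ∀ j k {S' : V} (r : S' ⟶ S), r ≫ t ≫ b = toUnit S' ≫ discι j →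
      r ≫ t ≫ c = toUnit S' ≫ discι k → Q i j k (r ≫ t) (r ≫ z))
    (fun i S S' r t z H j k S'' q hq hq' => by
      have := H j k (q ≫ r) (by rw [← hq, Category.assoc, Category.assoc])
        (by rw [← hq', Category.assoc, Category.assoc])
      rwa [Category.assoc, Category.assoc] at this)
    (fun i S t ht => hV.existsUnique_glue₂ (t ≫ b) (t ≫ c)
      (fun j k S' r z => Q i j k (r ≫ t) z)
      (fun j k S' S'' q r z H => by
        have := hQ i j k q _ _ H
        rwa [← Category.assoc] at this)
      (fun j k S' r hr hr' => h i j k (r ≫ t)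
        (by rw [Category.assoc, ht, ← Category.assoc]; exact congrArg (· ≫ _) (toUnit_unique _ _))
        (by rw [Category.assoc, hr]) (by rw [Category.assoc, hr'])))
  obtain ⟨f, hf, hfu⟩ := key
  refine ⟨f, fun i j k S t ha hb hc => ?_, fun g hg => hfu g fun i S t ha j k S' r hr hr' => ?_⟩
  · have := hf i t ha j k (𝟙 S) (by rw [Category.id_comp, hb]) (by rw [Category.id_comp, hc])
    rwa [Category.id_comp, Category.id_comp] at this
  · have := hg i j k (r ≫ t)
      (by rw [Category.assoc, ha, ← Category.assoc]; exact congrArg (· ≫ _) (toUnit_unique _ _))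
      (by rw [Category.assoc, hr]) (by rw [Category.assoc, hr'])
    rwa [Category.assoc] at this

end DecomposesOverDiscrete

/-! ### Morphisms into pullbacks -/

section PullbackLift

variable {C : Type u} [Category.{v} C] {X Y Z S T : C} {p : X ⟶ Z} {q : Y ⟶ Z} [HasPullback p q]

theorem comp_pullbackLift (r : S ⟶ T) (f : T ⟶ X) (g : T ⟶ Y) (h : f ≫ p = g ≫ q) :
    r ≫ pullback.lift f g h = pullback.lift (r ≫ f) (r ≫ g)
      (by rw [Category.assoc, h, Category.assoc]) :=
  pullback.hom_ext (by simp [pullback.lift_fst]) (by simp [pullback.lift_snd])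

theorem pullbackLift_congr {f f' : T ⟶ X} {g g' : T ⟶ Y} {h : f ≫ p = g ≫ q}
    {h' : f' ≫ p = g' ≫ q} (hf : f = f') (hg : g = g') :
    pullback.lift f g h = pullback.lift f' g' h' := by
  subst hf hg
  rfl

end PullbackLift

/-! ### Enriched categories in terms of generalized elements -/

section Elements

variable {V : Type u} [Category.{v} V] [CartesianMonoidalCategory V]

/-- An enriched category whose laws are given on generalized elements. -/
abbrev enrichedCategoryOfElements {I : Type w} (H : I → I → V) (id : ∀ i, 𝟙_ V ⟶ H i i)
    (comp : ∀ i j k, H i j ⊗ H j k ⟶ H i k)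
    (id_comp : ∀ i j, lift (toUnit (H i j) ≫ id i) (𝟙 _) ≫ comp i i j = 𝟙 _)
    (comp_id : ∀ i j, lift (𝟙 _) (toUnit (H i j) ≫ id j) ≫ comp i j j = 𝟙 _)
    (assoc : ∀ {i j k l} {T : V} (α : T ⟶ H i j) (β : T ⟶ H j k) (γ : T ⟶ H k l),
      lift (lift α β ≫ comp i j k) γ ≫ comp i k l =
        lift α (lift β γ ≫ comp j k l) ≫ comp i j l) :
    EnrichedCategory V I where
  Hom := H
  id := id
  comp := comp
  id_comp i j := by
    rw [← id_comp i j, ← Category.assoc]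
    congr 1
    ext <;> simp
  comp_id i j := by
    rw [← comp_id i j, ← Category.assoc]
    congr 1
    ext <;> simp
  assoc i j k l := by
    have h := assoc (fst (H i j) (H j k ⊗ H k l)) (snd _ _ ≫ fst _ _) (snd _ _ ≫ snd _ _)
    have h₁ : (α_ (H i j) (H j k) (H k l)).inv ≫ comp i j k ▷ H k l =
        lift (lift (fst (H i j) (H j k ⊗ H k l)) (snd _ _ ≫ fst _ _) ≫ comp i j k)
          (snd _ _ ≫ snd _ _) := by
      ext
      · simp only [Category.assoc, whiskerRight_fst, lift_fst]
        rw [← Category.assoc]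
        congr 1
        ext <;> simp
      · simp
    have h₂ : H i j ◁ comp j k l =
        lift (fst (H i j) (H j k ⊗ H k l))
          (lift (snd _ _ ≫ fst _ _) (snd _ _ ≫ snd _ _) ≫ comp j k l) := by
      ext
      · simp
      · simp only [whiskerLeft_snd, lift_snd]
        congr 1
        ext <;> simp
    rw [← Category.assoc, h₁, h, h₂]

variable {I : Type w} [EnrichedCategory V I]

theorem lift_eId_eComp {T : V} {i j : I} (α : T ⟶ (i ⟶[V] j)) :
    lift (toUnit T ≫ eId V i) α ≫ eComp V i i j = α := by
  have h := congrArg (α ≫ ·) (e_id_comp V i j)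
  rw [Category.comp_id, ← Category.assoc, ← Category.assoc] at h
  conv_rhs => rw [← h]
  congr 1
  ext
  · simp only [lift_fst, Category.assoc, whiskerRight_fst]
    rw [← Category.assoc, ← Category.assoc, toUnit_unique ((α ≫ _) ≫ _) (toUnit T)]
  · simp

theorem lift_eComp_eId {T : V} {i j : I} (α : T ⟶ (i ⟶[V] j)) :
    lift α (toUnit T ≫ eId V j) ≫ eComp V i j j = α := by
  have h := congrArg (α ≫ ·) (e_comp_id V i j)
  rw [Category.comp_id, ← Category.assoc, ← Category.assoc] at h
  conv_rhs => rw [← h]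
  congr 1
  ext
  · simp
  · simp only [lift_snd, Category.assoc, whiskerLeft_snd]
    rw [← Category.assoc, ← Category.assoc, toUnit_unique ((α ≫ _) ≫ _) (toUnit T)]

theorem lift_eComp_assoc {T : V} {i j k l : I} (α : T ⟶ (i ⟶[V] j)) (β : T ⟶ (j ⟶[V] k))
    (γ : T ⟶ (k ⟶[V] l)) :
    lift (lift α β ≫ eComp V i j k) γ ≫ eComp V i k l =
      lift α (lift β γ ≫ eComp V j k l) ≫ eComp V i j l := by
  have h := congrArg (lift α (lift β γ) ≫ ·) (e_assoc V i j k l)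
  simpa [← Category.assoc, lift_lift_associator_inv, lift_whiskerRight, lift_whiskerLeft] using h

end Elements

/-! ### The `V`-category of a discretely internal category -/

section En

variable {V : Type u} [Category.{v} V] [CartesianMonoidalCategory V] [HasCoproducts.{w} V]
  [HasPullbacks V]

namespace DiscIntCat

variable (C : DiscIntCat.{w} V)

/-- The span of the source and target morphisms of a discretely internal category. -/
def span : DiscSpan V C.objs C.objs := ⟨C.cat.Mor, C.cat.src, C.cat.tgt⟩

/-- The object of morphisms from `i` to `j`. -/
def hom (i j : C.objs) : V := enMatrix C.span i j

/-- The inclusion of the morphisms from `i` to `j` into all morphisms. -/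
def homι (i j : C.objs) : C.hom i j ⟶ C.cat.Mor := enι C.span i j

theorem homι_src (i j : C.objs) : C.homι i j ≫ C.cat.src = toUnit _ ≫ discι i :=
  enι_left V C.span i j

theorem homι_tgt (i j : C.objs) : C.homι i j ≫ C.cat.tgt = toUnit _ ≫ discι j :=
  enι_right V C.span i j

/-- The universal property of `C.hom i j`. -/
def homLift {i j : C.objs} {T : V} (f : T ⟶ C.cat.Mor) (hs : f ≫ C.cat.src = toUnit T ≫ discι i)
    (ht : f ≫ C.cat.tgt = toUnit T ≫ discι j) : T ⟶ C.hom i j :=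
  enLift C.span i j f hs ht

@[simp]
theorem homLift_homι {i j : C.objs} {T : V} (f : T ⟶ C.cat.Mor)
    (hs : f ≫ C.cat.src = toUnit T ≫ discι i) (ht : f ≫ C.cat.tgt = toUnit T ≫ discι j) :
    C.homLift f hs ht ≫ C.homι i j = f :=
  enLift_enι _ _ _ _ _ _ _

variable {C} in
theorem hom_hom_ext {i j : C.objs} {T : V} {f g : T ⟶ C.hom i j}
    (h : f ≫ C.homι i j = g ≫ C.homι i j) : f = g :=
  enMatrix_hom_ext C.span h

variable {C} in
theorem comp_homι_src {i j : C.objs} {T : V} (f : T ⟶ C.hom i j) :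
    (f ≫ C.homι i j) ≫ C.cat.src = toUnit T ≫ discι i := by
  rw [Category.assoc, homι_src, ← Category.assoc, toUnit_unique (f ≫ _) (toUnit T)]

variable {C} in
theorem comp_homι_tgt {i j : C.objs} {T : V} (f : T ⟶ C.hom i j) :
    (f ≫ C.homι i j) ≫ C.cat.tgt = toUnit T ≫ discι j := by
  rw [Category.assoc, homι_tgt, ← Category.assoc, toUnit_unique (f ≫ _) (toUnit T)]

variable {C} in
theorem comp_homι_tgt_eq_src {i j k : C.objs} {T : V} (f : T ⟶ C.hom i j) (g : T ⟶ C.hom j k) :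
    (f ≫ C.homι i j) ≫ C.cat.tgt = (g ≫ C.homι j k) ≫ C.cat.src :=
  (comp_homι_tgt f).trans (comp_homι_src g).symm

/-- Identities of the `V`-category of `C`. -/
def homId (i : C.objs) : 𝟙_ V ⟶ C.hom i i :=
  C.homLift (discι i ≫ C.cat.ident)
    (by rw [Category.assoc, C.cat.ident_src, Category.comp_id, toUnit_unique (toUnit _) (𝟙 _),
      Category.id_comp])
    (by rw [Category.assoc, C.cat.ident_tgt, Category.comp_id, toUnit_unique (toUnit _) (𝟙 _),
      Category.id_comp])

/-- Composition of the `V`-category of `C`. -/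
def homComp (i j k : C.objs) : C.hom i j ⊗ C.hom j k ⟶ C.hom i k :=
  C.homLift (pullback.lift (fst _ _ ≫ C.homι i j) (snd _ _ ≫ C.homι j k)
      (comp_homι_tgt_eq_src _ _) ≫ C.cat.comp)
    (by rw [Category.assoc, C.cat.comp_src, ← Category.assoc, pullback.lift_fst, comp_homι_src])
    (by rw [Category.assoc, C.cat.comp_tgt, ← Category.assoc, pullback.lift_snd, comp_homι_tgt])

theorem homId_homι (i : C.objs) : C.homId i ≫ C.homι i i = discι i ≫ C.cat.ident :=
  homLift_homι _ _ _ _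

theorem lift_homComp_homι {i j k : C.objs} {T : V} (f : T ⟶ C.hom i j) (g : T ⟶ C.hom j k) :
    (lift f g ≫ C.homComp i j k) ≫ C.homι i k =
      pullback.lift (f ≫ C.homι i j) (g ≫ C.homι j k) (comp_homι_tgt_eq_src f g) ≫ C.cat.comp := by
  rw [Category.assoc, homComp, homLift_homι, ← Category.assoc, comp_pullbackLift]
  congr 1
  exact pullbackLift_congr (lift_fst_assoc _ _ _) (lift_snd_assoc _ _ _)

/-- The enrichment of the set of objects of a discretely internal category. -/
instance enrichedCategory : EnrichedCategory V C.objs :=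
  enrichedCategoryOfElements C.hom C.homId C.homComp
    (fun i j => hom_hom_ext (by
      have h := congrArg (C.homι i j ≫ ·) C.cat.ident_comp
      rw [Category.comp_id (C.homι i j), ← Category.assoc, comp_pullbackLift] at h
      rw [lift_homComp_homι]
      refine (congrArg (· ≫ C.cat.comp) (pullbackLift_congr ?_ ?_)).trans
        (h.trans (Category.id_comp _).symm)
      · rw [Category.assoc, homId_homι, ← Category.assoc, ← homι_src, Category.assoc]
      · rw [Category.comp_id, Category.id_comp]))
    (fun i j => hom_hom_ext (by
      have h := congrArg (C.homι i j ≫ ·) C.cat.comp_ident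
      rw [Category.comp_id (C.homι i j), ← Category.assoc, comp_pullbackLift] at h
      rw [lift_homComp_homι]
      refine (congrArg (· ≫ C.cat.comp) (pullbackLift_congr ?_ ?_)).trans
        (h.trans (Category.id_comp _).symm)
      · rw [Category.comp_id, Category.id_comp]
      · rw [Category.assoc, homId_homι, ← Category.assoc, ← homι_tgt, Category.assoc]))
    (fun α β γ => hom_hom_ext (by
      simp only [lift_homComp_homι]
      exact C.cat.assoc _ _ _ (comp_homι_tgt_eq_src α β) (comp_homι_tgt_eq_src β γ)))

variable {C} {D : DiscIntCat.{w} V}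

/-- A morphism of discretely internal categories, on objects of morphisms from `i` to `j`. -/
def homMap (F : C ⟶ D) (i j : C.objs) : C.hom i j ⟶ D.hom (F.onObjs i) (F.onObjs j) :=
  D.homLift (C.homι i j ≫ F.functor.map)
    (by rw [Category.assoc, F.functor.map_src, ← Category.assoc, homι_src, Category.assoc,
      discι_discMap])
    (by rw [Category.assoc, F.functor.map_tgt, ← Category.assoc, homι_tgt, Category.assoc,
      discι_discMap])

theorem homMap_homι (F : C ⟶ D) (i j : C.objs) :
    homMap F i j ≫ D.homι _ _ = C.homι i j ≫ F.functor.map :=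
  homLift_homι _ _ _ _

/-- The `V`-functor of a morphism of discretely internal categories. -/
def enrichedFunctor (F : C ⟶ D) : EnrichedFunctor V C.objs D.objs where
  obj := F.onObjs
  map := homMap F
  map_id i := by
    refine hom_hom_ext (C := D) ?_
    change (C.homId i ≫ homMap F i i) ≫ _ = D.homId _ ≫ _
    rw [Category.assoc, homMap_homι, ← Category.assoc, homId_homι, Category.assoc,
      F.functor.map_ident, ← Category.assoc, discι_discMap, homId_homι]
  map_comp i j k := by
    refine hom_hom_ext (C := D) ?_
    change (C.homComp i j k ≫ homMap F i k) ≫ _ =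
      ((homMap F i j ⊗ₘ homMap F j k) ≫ D.homComp _ _ _) ≫ _
    have h : homMap F i j ⊗ₘ homMap F j k =
      lift (fst _ _ ≫ homMap F i j) (snd _ _ ≫ homMap F j k) := by ext <;> simp
    have h' := C.lift_homComp_homι (fst (C.hom i j) (C.hom j k)) (snd _ _)
    rw [lift_fst_snd, Category.id_comp] at h'
    rw [h, lift_homComp_homι, Category.assoc, homMap_homι, ← Category.assoc, h', Category.assoc,
      F.functor.map_comp, ← Category.assoc, comp_pullbackLift]
    congr 1
    refine pullbackLift_congr ?_ ?_
    · rw [← Category.assoc, pullback.lift_fst, Category.assoc, Category.assoc, homMap_homι]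
    · rw [← Category.assoc, pullback.lift_snd, Category.assoc, Category.assoc, homMap_homι]

end DiscIntCat

variable (V) in
/-- The functor from discretely internal categories to `V`-categories induced by `En`. -/
def enCat : DiscIntCat.{w} V ⥤ VCat.{w} V where
  obj C := ⟨C.objs⟩
  map F := DiscIntCat.enrichedFunctor F
  map_id C := EnrichedFunctor.ext V (fun _ => rfl) fun i j => by
    refine (Category.comp_id _).trans (DiscIntCat.hom_hom_ext (C := C) ?_)
    exact (DiscIntCat.homMap_homι (𝟙 C) i j).trans
      ((Category.comp_id _).trans (Category.id_comp _).symm)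
  map_comp {C D E} F G := EnrichedFunctor.ext V (fun _ => rfl) fun i j => by
    refine (Category.comp_id _).trans (DiscIntCat.hom_hom_ext (C := E) ?_)
    refine (DiscIntCat.homMap_homι (F ≫ G) i j).trans ?_
    change C.homι i j ≫ F.functor.map ≫ G.functor.map =
      (DiscIntCat.homMap F i j ≫ DiscIntCat.homMap G _ _) ≫ E.homι _ _
    rw [Category.assoc, DiscIntCat.homMap_homι, ← Category.assoc, ← Category.assoc,
      DiscIntCat.homMap_homι]

end En

/-! ### The discretely internal category of a `V`-category -/

section

variable {V : Type u} [Category.{v} V] [CartesianMonoidalCategory V] [HasCoproducts.{w} V]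

theorem comp_totalι_src {I J : Type w} {M : I → J → V} {i : I} {j : J} {T : V} (α : T ⟶ M i j) :
    (α ≫ totalι M i j) ≫ totalSrc M = toUnit T ≫ discι i := by
  rw [Category.assoc, totalι_totalSrc, ← Category.assoc, toUnit_unique (α ≫ _) (toUnit T)]

theorem comp_totalι_tgt {I J : Type w} {M : I → J → V} {i : I} {j : J} {T : V} (α : T ⟶ M i j) :
    (α ≫ totalι M i j) ≫ totalTgt M = toUnit T ≫ discι j := by
  rw [Category.assoc, totalι_totalTgt, ← Category.assoc, toUnit_unique (α ≫ _) (toUnit T)]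

variable (V) in
/-- The matrix of hom-objects of a `V`-category. -/
abbrev homMatrix (I : Type w) [EnrichedCategory V I] : I → I → V := fun i j => i ⟶[V] j

variable (I : Type w) [EnrichedCategory V I]

variable (V) in
/-- The identities of the internal category of a `V`-category. -/
def totalId : disc V I ⟶ total (homMatrix V I) :=
  Limits.Sigma.desc fun i => eId V i ≫ totalι (homMatrix V I) i i

theorem discι_totalId (i : I) :
    discι i ≫ totalId V I = eId V i ≫ totalι (homMatrix V I) i i :=
  Limits.Sigma.ι_desc _ _

theorem toUnit_discι_totalId (i : I) (T : V) :
    (toUnit T ≫ discι i) ≫ totalId V I = (toUnit T ≫ eId V i) ≫ totalι (homMatrix V I) i i := by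
  rw [Category.assoc, discι_totalId, Category.assoc]

end

namespace DecomposesOverDiscrete

variable {V : Type u} [Category.{v} V] [CartesianMonoidalCategory V] [HasCoproducts.{w} V]
  [HasPullbacks V] (hV : DecomposesOverDiscrete.{w} V)

include hV

theorem totalι_injective {I J : Type w} {M : I → J → V} {i : I} {j : J} {T : V}
    {α β : T ⟶ M i j} (h : α ≫ totalι M i j = β ≫ totalι M i j) : α = β :=
  (hV.factor M (β ≫ totalι M i j) (comp_totalι_src β) (comp_totalι_tgt β)).unique h rfl

/-- Morphisms out of an object over `total M` may be compared on generalized elements lying in a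
single entry of `M`. -/
theorem hom_ext_total {I J : Type w} {M : I → J → V} {A Z : V} (m : A ⟶ total M) {f g : A ⟶ Z}
    (h : ∀ i j {S : V} (t : S ⟶ A) (α : S ⟶ M i j), t ≫ m = α ≫ totalι M i j →
      t ≫ f = t ≫ g) : f = g := by
  refine hV.hom_ext (m ≫ totalSrc M) fun i S t hi => ?_
  refine hV.hom_ext (t ≫ m ≫ totalTgt M) fun j S' r hj => ?_
  obtain ⟨α, hα, -⟩ := hV.factor M (i := i) (j := j) ((r ≫ t) ≫ m)
    (by
      rw [Category.assoc, Category.assoc, hi, ← Category.assoc]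
      exact congrArg (· ≫ _) (toUnit_unique _ _))
    (by rw [Category.assoc, Category.assoc, hj])
  have := h i j (r ≫ t) α hα.symm
  rwa [Category.assoc, Category.assoc] at this

/-- Morphisms out of an object of composable pairs may be compared on pairs of generalized elements
lying in single entries with a common middle index. -/
theorem hom_ext_total₂ {I J K : Type w} {M : I → J → V} {N : J → K → V} {A Z : V}
    (m : A ⟶ total M) (n : A ⟶ total N) (hmn : m ≫ totalTgt M = n ≫ totalSrc N) {f g : A ⟶ Z}
    (h : ∀ i j k {S : V} (t : S ⟶ A) (α : S ⟶ M i j) (β : S ⟶ N j k),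
      t ≫ m = α ≫ totalι M i j → t ≫ n = β ≫ totalι N j k → t ≫ f = t ≫ g) : f = g := by
  refine hV.hom_ext_total m fun i j S t α hα => ?_
  refine hV.hom_ext (t ≫ n ≫ totalTgt N) fun k S' r hk => ?_
  obtain ⟨β, hβ, -⟩ := hV.factor N (i := j) (j := k) ((r ≫ t) ≫ n)
    (by
      rw [Category.assoc, ← hmn, Category.assoc, ← Category.assoc t, hα, comp_totalι_tgt,
        ← Category.assoc]
      exact congrArg (· ≫ _) (toUnit_unique _ _))
    (by rw [Category.assoc, Category.assoc, hk])
  have := h i j k (r ≫ t) (r ≫ α) β (by rw [Category.assoc, hα, Category.assoc]) hβ.symm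
  rwa [Category.assoc, Category.assoc] at this

/-- A family of morphisms `M i j ⊗ N j k ⟶ P i k` defines a morphism from the pullback of `total M`
and `total N` to `total P`. -/
theorem exists_totalComp {I J K : Type w} {M : I → J → V} {N : J → K → V} {P : I → K → V}
    (c : ∀ i j k, M i j ⊗ N j k ⟶ P i k) :
    ∃ f : pullback (totalTgt M) (totalSrc N) ⟶ total P,
      ∀ i j k {S : V} (α : S ⟶ M i j) (β : S ⟶ N j k)
        (h : (α ≫ totalι M i j) ≫ totalTgt M = (β ≫ totalι N j k) ≫ totalSrc N),
        pullback.lift (α ≫ totalι M i j) (β ≫ totalι N j k) h ≫ f =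
          (lift α β ≫ c i j k) ≫ totalι P i k := by
  let p := pullback.fst (totalTgt M) (totalSrc N)
  let q := pullback.snd (totalTgt M) (totalSrc N)
  -- A pair over `(i, j, k)` consists of unique elements of `M i j` and `N j k`. The property asks for
  -- the existence of these elements, so that it is stable under restriction.
  obtain ⟨f, hf, -⟩ := hV.existsUnique_glue₃ (Z := total P) (p ≫ totalSrc M) (p ≫ totalTgt M)
    (q ≫ totalTgt N)
    (fun i j k S t z => ∃ (α : S ⟶ M i j) (β : S ⟶ N j k), α ≫ totalι M i j = t ≫ p ∧
      β ≫ totalι N j k = t ≫ q ∧ z = (lift α β ≫ c i j k) ≫ totalι P i k)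
    (by
      rintro i j k S S' r t z ⟨α, β, hα, hβ, rfl⟩
      exact ⟨r ≫ α, r ≫ β, by rw [Category.assoc, hα, Category.assoc],
        by rw [Category.assoc, hβ, Category.assoc],
        by rw [← comp_lift, Category.assoc, Category.assoc, Category.assoc]⟩)
    (fun i j k S t hi hj hk => by
      have hj' : t ≫ q ≫ totalSrc N = toUnit S ≫ discι j := by
        rw [← hj]
        exact congrArg (t ≫ ·) pullback.condition.symm
      obtain ⟨α, hα, hαu⟩ := hV.factor M (t ≫ p) (by rw [Category.assoc, hi])
        (by rw [Category.assoc, hj])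
      obtain ⟨β, hβ, hβu⟩ := hV.factor N (t ≫ q) (by rw [Category.assoc, hj'])
        (by rw [Category.assoc, hk])
      refine ⟨_, ⟨α, β, hα, hβ, rfl⟩, ?_⟩
      rintro z ⟨α', β', hα', hβ', rfl⟩
      rw [hαu α' hα', hβu β' hβ'])
  refine ⟨f, fun i j k S α β h => ?_⟩
  have hp : pullback.lift (α ≫ totalι M i j) (β ≫ totalι N j k) h ≫ p = α ≫ totalι M i j :=
    pullback.lift_fst _ _ _
  have hq : pullback.lift (α ≫ totalι M i j) (β ≫ totalι N j k) h ≫ q = β ≫ totalι N j k :=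
    pullback.lift_snd _ _ _
  obtain ⟨α', β', hα', hβ', hz⟩ := hf i j k (pullback.lift _ _ h)
    (by rw [← Category.assoc, hp, comp_totalι_src]) (by rw [← Category.assoc, hp, comp_totalι_tgt])
    (by rw [← Category.assoc, hq, comp_totalι_tgt])
  rw [hz, hV.totalι_injective (hα'.trans hp), hV.totalι_injective (hβ'.trans hq)]

section

variable (I : Type w) [EnrichedCategory V I]

/-- The composition of the internal category of a `V`-category. -/
def totalComp : pullback (totalTgt (homMatrix V I)) (totalSrc (homMatrix V I)) ⟶
    total (homMatrix V I) :=
  (hV.exists_totalComp (M := homMatrix V I) (N := homMatrix V I) (P := homMatrix V I)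
    fun i j k => eComp V i j k).choose

variable {I} in
theorem lift_totalComp {i j k : I} {S : V} (α : S ⟶ (i ⟶[V] j)) (β : S ⟶ (j ⟶[V] k))
    {f g : S ⟶ total (homMatrix V I)}
    (hf : f = α ≫ totalι (homMatrix V I) i j) (hg : g = β ≫ totalι (homMatrix V I) j k)
    (h : f ≫ totalTgt (homMatrix V I) = g ≫ totalSrc (homMatrix V I)) :
    pullback.lift f g h ≫ hV.totalComp I =
      (lift α β ≫ eComp V i j k) ≫ totalι (homMatrix V I) i k := by
  subst hf hg
  exact (hV.exists_totalComp (M := homMatrix V I) (N := homMatrix V I) (P := homMatrix V I)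
    fun i j k => eComp V i j k).choose_spec i j k α β h

theorem pullback_totalComp {i j k : I} {S : V} (t : S ⟶ pullback _ _)
    (α : S ⟶ (i ⟶[V] j)) (β : S ⟶ (j ⟶[V] k))
    (hf : t ≫ pullback.fst _ _ = α ≫ totalι (homMatrix V I) i j)
    (hg : t ≫ pullback.snd _ _ = β ≫ totalι (homMatrix V I) j k) :
    t ≫ hV.totalComp I = (lift α β ≫ eComp V i j k) ≫ totalι (homMatrix V I) i k := by
  rw [← hV.lift_totalComp α β hf hg
    (by rw [Category.assoc, Category.assoc, pullback.condition])]
  congr 1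
  exact pullback.hom_ext (pullback.lift_fst _ _ _).symm (pullback.lift_snd _ _ _).symm

/-- The internal category of a `V`-category: its object of morphisms is the coproduct of all the
hom-objects. -/
def internalCategory : InternalCategoryOn (disc V I) where
  Mor := total (homMatrix V I)
  src := totalSrc (homMatrix V I)
  tgt := totalTgt (homMatrix V I)
  ident := totalId V I
  comp := hV.totalComp I
  ident_src := disc_hom_ext fun i => by
    rw [← Category.assoc, discι_totalId, comp_totalι_src, Category.comp_id,
      toUnit_unique (toUnit _) (𝟙 _), Category.id_comp]
  ident_tgt := disc_hom_ext fun i => by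
    rw [← Category.assoc, discι_totalId, comp_totalι_tgt, Category.comp_id,
      toUnit_unique (toUnit _) (𝟙 _), Category.id_comp]
  comp_src := hV.hom_ext_total₂ (pullback.fst _ _) (pullback.snd _ _) pullback.condition
    fun i j k S t α β hα hβ => by
      rw [← Category.assoc, hV.pullback_totalComp I t α β hα hβ, ← Category.assoc, hα,
        comp_totalι_src, comp_totalι_src]
  comp_tgt := hV.hom_ext_total₂ (pullback.fst _ _) (pullback.snd _ _) pullback.condition
    fun i j k S t α β hα hβ => by
      rw [← Category.assoc, hV.pullback_totalComp I t α β hα hβ, ← Category.assoc, hβ,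
        comp_totalι_tgt, comp_totalι_tgt]
  ident_comp := total_hom_ext fun i j => by
    rw [← Category.assoc, comp_pullbackLift, hV.lift_totalComp (toUnit _ ≫ eId V i) (𝟙 _)
      (by rw [← Category.assoc, totalι_totalSrc, toUnit_discι_totalId])
      (by rw [Category.comp_id, Category.id_comp]), lift_eId_eComp, Category.id_comp,
      Category.comp_id]
  comp_ident := total_hom_ext fun i j => by
    rw [← Category.assoc, comp_pullbackLift, hV.lift_totalComp (𝟙 _) (toUnit _ ≫ eId V j)
      (by rw [Category.comp_id, Category.id_comp])
      (by rw [← Category.assoc, totalι_totalTgt, toUnit_discι_totalId]), lift_eComp_eId,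
      Category.id_comp, Category.comp_id]
  assoc {T} f g h hfg hgh := by
    refine hV.hom_ext_total₂ f g hfg fun i j k S t α β hα hβ => ?_
    refine hV.hom_ext (t ≫ h ≫ totalTgt (homMatrix V I)) fun l S' r hl => ?_
    obtain ⟨γ, hγ : γ ≫ _ = _, -⟩ := hV.factor (homMatrix V I) (i := k) (j := l) ((r ≫ t) ≫ h)
      (by
        rw [Category.assoc, ← hgh, Category.assoc, ← Category.assoc t, hβ, comp_totalι_tgt,
          ← Category.assoc]
        exact congrArg (· ≫ _) (toUnit_unique _ _))
      (by rw [Category.assoc, Category.assoc, hl])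
    have hα' : (r ≫ t) ≫ f = (r ≫ α) ≫ totalι (homMatrix V I) i j := by
      rw [Category.assoc, hα, Category.assoc]
    have hβ' : (r ≫ t) ≫ g = (r ≫ β) ≫ totalι (homMatrix V I) j k := by
      rw [Category.assoc, hβ, Category.assoc]
    rw [← Category.assoc t, ← Category.assoc t, ← Category.assoc r, ← Category.assoc r,
      ← Category.assoc r, ← Category.assoc r, comp_pullbackLift, comp_pullbackLift,
      hV.lift_totalComp (lift (r ≫ α) (r ≫ β) ≫ eComp V i j k) γ ?_ hγ.symm,
      hV.lift_totalComp (r ≫ α) (lift (r ≫ β) γ ≫ eComp V j k l) hα' ?_, lift_eComp_assoc]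
    · rw [← Category.assoc, comp_pullbackLift, hV.lift_totalComp _ _ hβ' hγ.symm]
    · rw [← Category.assoc, comp_pullbackLift, hV.lift_totalComp _ _ hα' hβ']

end

end DecomposesOverDiscrete

/-! ### The equivalence -/

namespace DecomposesOverDiscrete

variable {V : Type u} [Category.{v} V] [CartesianMonoidalCategory V] [HasCoproducts.{w} V]
  [HasPullbacks V] (hV : DecomposesOverDiscrete.{w} V)
include hV

section Morphisms

variable {C D : DiscIntCat.{w} V}

/-- The inclusions of the hom-objects are jointly epimorphic. -/
theorem mor_hom_ext {Z : V} {f g : C.cat.Mor ⟶ Z}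
    (h : ∀ i j, C.homι i j ≫ f = C.homι i j ≫ g) : f = g := by
  refine hV.hom_ext C.cat.src fun i S t hi => hV.hom_ext (t ≫ C.cat.tgt) fun j S' r hj => ?_
  obtain ⟨α, hα⟩ : ∃ α : S' ⟶ C.hom i j, α ≫ C.homι i j = r ≫ t :=
    ⟨_, C.homLift_homι (r ≫ t)
      (by
        rw [Category.assoc, hi, ← Category.assoc]
        exact congrArg (· ≫ _) (toUnit_unique _ _))
      (by rw [Category.assoc, hj])⟩
  rw [← Category.assoc, ← Category.assoc, ← hα, Category.assoc, Category.assoc, h]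

/-- The inclusions of the products of hom-objects into the object of composable pairs are jointly
epimorphic. -/
theorem mor_hom_ext₂ {Z : V} {f g : pullback C.cat.tgt C.cat.src ⟶ Z}
    (h : ∀ i j k {S : V} (α : S ⟶ C.hom i j) (β : S ⟶ C.hom j k),
      pullback.lift (α ≫ C.homι i j) (β ≫ C.homι j k) (DiscIntCat.comp_homι_tgt_eq_src α β) ≫ f =
        pullback.lift (α ≫ C.homι i j) (β ≫ C.homι j k)
          (DiscIntCat.comp_homι_tgt_eq_src α β) ≫ g) : f = g := by
  refine hV.hom_ext (pullback.fst _ _ ≫ C.cat.src) fun i S t hi =>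
    hV.hom_ext (t ≫ pullback.fst _ _ ≫ C.cat.tgt) fun j S' r hj =>
      hV.hom_ext (r ≫ t ≫ pullback.snd _ _ ≫ C.cat.tgt) fun k S'' q hk => ?_
  have hu (X Y : V) (s : X ⟶ Y) (i : C.objs) :
      s ≫ toUnit Y ≫ discι i = toUnit X ≫ discι i := by
    rw [← Category.assoc, toUnit_unique (s ≫ toUnit Y) (toUnit X)]
  have hi' : (q ≫ r ≫ t ≫ pullback.fst C.cat.tgt C.cat.src) ≫ C.cat.src =
      toUnit S'' ≫ discι i := by
    simp only [Category.assoc, hi, hu]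
  have hj' : (q ≫ r ≫ t ≫ pullback.fst C.cat.tgt C.cat.src) ≫ C.cat.tgt =
      toUnit S'' ≫ discι j := by
    simp only [Category.assoc, hj, hu]
  have hj'' : (q ≫ r ≫ t ≫ pullback.snd C.cat.tgt C.cat.src) ≫ C.cat.src =
      toUnit S'' ≫ discι j := by
    rw [← hj']
    simp only [Category.assoc, pullback.condition]
  have hk' : (q ≫ r ≫ t ≫ pullback.snd C.cat.tgt C.cat.src) ≫ C.cat.tgt =
      toUnit S'' ≫ discι k := by
    simp only [Category.assoc, hk]
  have key : q ≫ r ≫ t = pullback.lift (C.homLift _ hi' hj' ≫ C.homι i j)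
      (C.homLift _ hj'' hk' ≫ C.homι j k) (DiscIntCat.comp_homι_tgt_eq_src _ _) := by
    apply pullback.hom_ext
    · rw [pullback.lift_fst, DiscIntCat.homLift_homι, Category.assoc, Category.assoc]
    · rw [pullback.lift_snd, DiscIntCat.homLift_homι, Category.assoc, Category.assoc]
  have := h i j k (C.homLift _ hi' hj') (C.homLift _ hj'' hk')
  rw [← key] at this
  simpa only [Category.assoc] using this

theorem exists_mor_desc {Z : V} (φ : ∀ i j, C.hom i j ⟶ Z) :
    ∃ f : C.cat.Mor ⟶ Z, ∀ i j, C.homι i j ≫ f = φ i j := by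
  obtain ⟨f, hf, -⟩ := hV.existsUnique_glue₂ (Z := Z) C.cat.src C.cat.tgt
    (fun i j S t z => ∃ α : S ⟶ C.hom i j, α ≫ C.homι i j = t ∧ z = α ≫ φ i j)
    (by
      rintro i j S S' r t z ⟨α, rfl, rfl⟩
      exact ⟨r ≫ α, Category.assoc _ _ _, (Category.assoc _ _ _).symm⟩)
    (fun i j S t hi hj => by
      refine ⟨_, ⟨C.homLift t hi hj, C.homLift_homι _ _ _, rfl⟩, ?_⟩
      rintro z ⟨α, hα, rfl⟩
      rw [DiscIntCat.hom_hom_ext (hα.trans (C.homLift_homι t hi hj).symm)])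
  refine ⟨f, fun i j => ?_⟩
  obtain ⟨α, hα, h⟩ := hf i j (C.homι i j) (C.homι_src i j) (C.homι_tgt i j)
  rw [h, DiscIntCat.hom_hom_ext (hα.trans (Category.id_comp _).symm), Category.id_comp]

theorem faithful_enCat : (enCat.{w} V).Faithful where
  map_injective {C D} F G h := by
    obtain ⟨u, F⟩ := F
    obtain ⟨u', G⟩ := G
    obtain rfl : u = u' := congrArg EnrichedFunctor.obj h
    have h' := eq_of_heq (EnrichedFunctor.mk.inj h).2
    refine DiscIntCat.Hom.ext' rfl (hV.mor_hom_ext fun i j => ?_)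
    exact (DiscIntCat.homMap_homι (C := C) (D := D) ⟨u, F⟩ i j).symm.trans
      ((congrArg (· ≫ D.homι _ _) (congrFun (congrFun h' i) j)).trans
        (DiscIntCat.homMap_homι (C := C) (D := D) ⟨u, G⟩ i j))

theorem full_enCat : (enCat.{w} V).Full where
  map_surjective {C D} P := by
    let u : C.objs → D.objs := EnrichedFunctor.obj P
    let p (i j : C.objs) : C.hom i j ⟶ D.hom (u i) (u j) := EnrichedFunctor.map P i j
    have hid (i : C.objs) : C.homId i ≫ p i i = D.homId (u i) := EnrichedFunctor.map_id P i
    have hcomp (i j k : C.objs) :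
        C.homComp i j k ≫ p i k = (p i j ⊗ₘ p j k) ≫ D.homComp (u i) (u j) (u k) :=
      EnrichedFunctor.map_comp P i j k
    obtain ⟨f, hf⟩ := hV.exists_mor_desc (C := C) fun i j => p i j ≫ D.homι _ _
    let F : C ⟶ D :=
      { onObjs := u
        functor :=
          { map := f
            map_src := hV.mor_hom_ext fun i j => by
              rw [← Category.assoc, hf, DiscIntCat.comp_homι_src, ← Category.assoc,
                DiscIntCat.homι_src, Category.assoc, discι_discMap]
            map_tgt := hV.mor_hom_ext fun i j => by
              rw [← Category.assoc, hf, DiscIntCat.comp_homι_tgt, ← Category.assoc,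
                DiscIntCat.homι_tgt, Category.assoc, discι_discMap]
            map_ident := disc_hom_ext fun i => by
              rw [← Category.assoc, ← DiscIntCat.homId_homι, Category.assoc, hf, ← Category.assoc,
                hid, DiscIntCat.homId_homι, ← Category.assoc, discι_discMap]
            map_comp := hV.mor_hom_ext₂ fun i j k S α β => by
              rw [← Category.assoc, ← DiscIntCat.lift_homComp_homι, Category.assoc, hf,
                Category.assoc, ← Category.assoc (C.homComp i j k), hcomp, ← Category.assoc,
                ← Category.assoc, lift_map, DiscIntCat.lift_homComp_homι, ← Category.assoc,
                comp_pullbackLift]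
              congr 1
              refine pullbackLift_congr ?_ ?_
              · rw [← Category.assoc, pullback.lift_fst, Category.assoc, Category.assoc, hf]
              · rw [← Category.assoc, pullback.lift_snd, Category.assoc, Category.assoc, hf] } }
    refine ⟨F, EnrichedFunctor.ext V (fun _ => rfl) fun i j => (Category.comp_id _).trans ?_⟩
    exact DiscIntCat.hom_hom_ext (C := D) ((DiscIntCat.homMap_homι F i j).trans (hf i j))

end Morphisms

section EssSurj

variable (I : Type w) [EnrichedCategory V I]

/-- The discretely internal category of a `V`-category. -/
def discIntCat : DiscIntCat.{w} V := ⟨I, hV.internalCategory I⟩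

/-- The hom-objects of the internal category of a `V`-category, in terms of their inclusions. -/
theorem discIntCat_existsUnique_factor (i j : I) :
    ∃! g : (hV.discIntCat I).hom i j ⟶ (i ⟶[V] j),
      g ≫ totalι (homMatrix V I) i j = (hV.discIntCat I).homι i j :=
  hV.factor (homMatrix V I) ((hV.discIntCat I).homι i j) ((hV.discIntCat I).homι_src i j)
    ((hV.discIntCat I).homι_tgt i j)

/-- The hom-objects of the internal category of a `V`-category are those of the `V`-category. -/
def ofDiscIntCatHom (i j : I) : (hV.discIntCat I).hom i j ⟶ (i ⟶[V] j) :=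
  (hV.discIntCat_existsUnique_factor I i j).choose

theorem ofDiscIntCatHom_totalι (i j : I) :
    hV.ofDiscIntCatHom I i j ≫ totalι (homMatrix V I) i j = (hV.discIntCat I).homι i j :=
  (hV.discIntCat_existsUnique_factor I i j).choose_spec.1

/-- The inverse of `ofDiscIntCatHom`. -/
def toDiscIntCatHom (i j : I) : (i ⟶[V] j) ⟶ (hV.discIntCat I).hom i j :=
  (hV.discIntCat I).homLift (i := i) (j := j) (totalι (homMatrix V I) i j)
    (totalι_totalSrc (homMatrix V I) i j) (totalι_totalTgt (homMatrix V I) i j)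

theorem toDiscIntCatHom_homι (i j : I) :
    hV.toDiscIntCatHom I i j ≫ (hV.discIntCat I).homι i j = totalι (homMatrix V I) i j :=
  (hV.discIntCat I).homLift_homι _ _ _

theorem discIntCat_homId_homι (i : I) :
    (hV.discIntCat I).homId i ≫ (hV.discIntCat I).homι i i =
      eId V i ≫ totalι (homMatrix V I) i i :=
  ((hV.discIntCat I).homId_homι i).trans (discι_totalId I i)

/-- Composition in the internal category of a `V`-category, on elements of hom-objects. -/
theorem discIntCat_lift_homComp_homι {i j k : I} {S : V} (α : S ⟶ (hV.discIntCat I).hom i j)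
    (β : S ⟶ (hV.discIntCat I).hom j k) (α' : S ⟶ (i ⟶[V] j)) (β' : S ⟶ (j ⟶[V] k))
    (hα : α ≫ (hV.discIntCat I).homι i j = α' ≫ totalι (homMatrix V I) i j)
    (hβ : β ≫ (hV.discIntCat I).homι j k = β' ≫ totalι (homMatrix V I) j k) :
    (lift α β ≫ (hV.discIntCat I).homComp i j k) ≫ (hV.discIntCat I).homι i k =
      (lift α' β' ≫ eComp V i j k) ≫ totalι (homMatrix V I) i k :=
  ((hV.discIntCat I).lift_homComp_homι α β).trans
    (hV.lift_totalComp α' β' hα hβ (DiscIntCat.comp_homι_tgt_eq_src α β))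

/-- The comparison functor from the `V`-category of the internal category of `I` to `I`. -/
def ofDiscIntCat : EnrichedFunctor V (hV.discIntCat I).objs I where
  obj i := i
  map := hV.ofDiscIntCatHom I
  map_id i := hV.totalι_injective (M := homMatrix V I) (by
    refine (Category.assoc _ _ _).trans ?_
    exact (congrArg (_ ≫ ·) (hV.ofDiscIntCatHom_totalι I i i)).trans
      (hV.discIntCat_homId_homι I i))
  map_comp i j k := hV.totalι_injective (M := homMatrix V I) (by
    refine (Category.assoc _ _ _).trans ?_
    refine (congrArg (_ ≫ ·) (hV.ofDiscIntCatHom_totalι I i k)).trans ?_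
    have h := hV.discIntCat_lift_homComp_homι I (i := i) (j := j) (k := k) (fst _ _) (snd _ _)
      (fst _ _ ≫ hV.ofDiscIntCatHom I i j) (snd _ _ ≫ hV.ofDiscIntCatHom I j k)
      (((Category.assoc _ _ _).trans (congrArg (_ ≫ ·) (hV.ofDiscIntCatHom_totalι I i j))).symm)
      (((Category.assoc _ _ _).trans (congrArg (_ ≫ ·) (hV.ofDiscIntCatHom_totalι I j k))).symm)
    have h' : hV.ofDiscIntCatHom I i j ⊗ₘ hV.ofDiscIntCatHom I j k =
        lift (fst _ _ ≫ hV.ofDiscIntCatHom I i j) (snd _ _ ≫ hV.ofDiscIntCatHom I j k) := by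
      ext <;> simp
    rw [lift_fst_snd, Category.id_comp, ← h'] at h
    exact h)

/-- The comparison functor from a `V`-category `I` to the `V`-category of its internal category. -/
def toDiscIntCat : EnrichedFunctor V I (hV.discIntCat I).objs where
  obj i := i
  map := hV.toDiscIntCatHom I
  map_id i := DiscIntCat.hom_hom_ext (C := hV.discIntCat I) (by
    refine (Category.assoc _ _ _).trans ?_
    rw [hV.toDiscIntCatHom_homι]
    exact (hV.discIntCat_homId_homι I i).symm)
  map_comp i j k := DiscIntCat.hom_hom_ext (C := hV.discIntCat I) (by
    refine (Category.assoc _ _ _).trans ?_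
    rw [hV.toDiscIntCatHom_homι]
    have h := hV.discIntCat_lift_homComp_homι I (i := i) (j := j) (k := k)
      (fst _ _ ≫ hV.toDiscIntCatHom I i j) (snd _ _ ≫ hV.toDiscIntCatHom I j k) (fst _ _) (snd _ _)
      ((Category.assoc _ _ _).trans (congrArg (_ ≫ ·) (hV.toDiscIntCatHom_homι I i j)))
      ((Category.assoc _ _ _).trans (congrArg (_ ≫ ·) (hV.toDiscIntCatHom_homι I j k)))
    have h' : hV.toDiscIntCatHom I i j ⊗ₘ hV.toDiscIntCatHom I j k =
        lift (fst _ _ ≫ hV.toDiscIntCatHom I i j) (snd _ _ ≫ hV.toDiscIntCatHom I j k) := by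
      ext <;> simp
    rw [lift_fst_snd, Category.id_comp, ← h'] at h
    exact h.symm)

/-- A `V`-category is isomorphic to the `V`-category of its internal category. -/
def enCatObjDiscIntCatIso (X : VCat.{w} V) :
    (enCat V).obj (hV.discIntCat X.carrier) ≅ X where
  hom := hV.ofDiscIntCat X.carrier
  inv := hV.toDiscIntCat X.carrier
  hom_inv_id := EnrichedFunctor.ext V (fun _ => rfl) fun i j => (Category.comp_id _).trans
    (DiscIntCat.hom_hom_ext (C := hV.discIntCat X.carrier) (by
      refine (Category.assoc _ _ _).trans ((congrArg (hV.ofDiscIntCatHom X.carrier i j ≫ ·)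
        (hV.toDiscIntCatHom_homι X.carrier i j)).trans ?_)
      exact (hV.ofDiscIntCatHom_totalι X.carrier i j).trans (Category.id_comp _).symm))
  inv_hom_id := EnrichedFunctor.ext V (fun _ => rfl) fun i j => (Category.comp_id _).trans
    (hV.totalι_injective (M := homMatrix V X.carrier) (by
      refine (Category.assoc _ _ _).trans ((congrArg (hV.toDiscIntCatHom X.carrier i j ≫ ·)
        (hV.ofDiscIntCatHom_totalι X.carrier i j)).trans ?_)
      exact (hV.toDiscIntCatHom_homι X.carrier i j).trans (Category.id_comp _).symm))

end EssSurj

theorem isEquivalence_enCat : (enCat.{w} V).IsEquivalence where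
  faithful := hV.faithful_enCat
  full := hV.full_enCat
  essSurj := ⟨fun X => ⟨_, ⟨hV.enCatObjDiscIntCatIso X⟩⟩⟩

end DecomposesOverDiscrete

end EnrichedInternal

end

theorem mainTheorem4 (V : Type u) [Category.{v} V] [CartesianMonoidalCategory V]
    [MonoidalClosed V] [HasFiniteLimits V] [HasCoproducts.{w} V]
    (hV : EnrichedInternal.DiscAdjunctionsAreEquivalences.{w} V ∨
      EnrichedInternal.IsExtensive.{w} V ∨
      EnrichedInternal.IntIsDoubleEquivalence.{w} V ∨
      EnrichedInternal.EnIsDoubleEquivalence.{w} V) :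
    Nonempty (EnrichedInternal.VCat.{w} V ≌ EnrichedInternal.DiscIntCat.{w} V) := by
  have h : EnrichedInternal.DecomposesOverDiscrete.{w} V := by
    rcases hV with h | h | h | h
    · exact h.decomposesOverDiscrete
    · exact h.discAdjunctionsAreEquivalences.decomposesOverDiscrete
    · exact h.decomposesOverDiscrete
    · exact h.decomposesOverDiscrete
  have := h.isEquivalence_enCat
  exact ⟨(EnrichedInternal.enCat.{w} V).asEquivalence.symm⟩
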